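/- Let $k$ be an algebraically closed field of characteristic $3$. Let $\Gamma$ be the weighted dual graph with seven vertices $E_1,\dots,E_7$, all of genus $0$, with edges $E_1E_2,\ E_2E_3,\ E_1E_4,\ E_1E_5,\ E_3E_6,\ E_3E_7$ and self-intersection numbers $E_2^2=-3$ and $E_i^2=-2$ for $i\ne 2$. Then $\Gamma$ is a ${}_*\tilde D_{n+3}$ graph with $n=3$: a chain of $n\ge 2$ curves of self-intersection at most $-2$, with two further curves of self-intersection $-2$ attached to each of its two end curves. An admissible choice of multiplicities for $\Gamma$ is $$\nu_1=\nu_3=28,\quad \nu_2=20,\quad \nu_4=\nu_5=\nu_6=\nu_7=16 .$$ Here admissible means that $\nu_i=\nu\tilde\nu_i$, where the $\tilde\nu_i$ are positive integers prime to $3$ with $\tilde Z\cdot E_i<0$ for all $i$, $\tilde Z=\sum_i\tilde\nu_iE_i$, and where, for some sequence $0=\tilde Z_0<\tilde Z_1<\dots<\tilde Z_m=\tilde Z$ with $\tilde Z_{l+1}=\tilde Z_l+E_{i_l}$, one has $\tau:=\max_{0\le l<m}\tilde Z_l\cdot E_{i_l}\ge 1$ and $\nu$ is the least integer prime to $3$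 with $\nu\ge\tau+\lambda+1$, $\lambda:=\max_i(0,-4,-2-E_i^2)$. Let $P$ be the plumbing scheme of $\Gamma$ with these multiplicities, i.e. the $k$-scheme glued from the affine charts $$\begin{aligned} &\operatorname{Spec} k[x_0,y_0]/\big((x_0-1)^{\nu_5}x_0^{\nu_4}y_0^{\nu_1}\big), &&\operatorname{Spec} k[x_3,y_3]/\big((x_3-1)^{\nu_7}x_3^{\nu_6}y_3^{\nu_3}\big),\\ &\operatorname{Spec} k[x_1,y_1,(1-x_1)^{-1}]/\big(x_1^{\nu_2}y_1^{\nu_1}\big), &&\operatorname{Spec} k[x_2,y_2,(1-y_2)^{-1}]/\big(x_2^{\nu_3}y_2^{\nu_2}\big),\\ &\operatorname{Spec} k[u_i,v_i]/\big(v_i^{\nu_i}\big)\quad (i=4,5,6,7) \end{aligned}$$ by the coordinate changes $x_1=x_0^{-1},\ y_1=x_0^{2}y_0$; $\ x_2=y_1^{-1},\ y_2=x_1y_1^{3}$; $\ y_2=x_3^{-1},\ x_2=x_3^{2}y_3$; $\ u_4=y_0^{-1},\ v_4=x_0y_0^{2}$; $\ u_5=y_0^{-1},\ v_5=(x_0-1)y_0^{2}$;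 $\ u_6=y_3^{-1},\ v_6=x_3y_3^{2}$; $\ u_7=y_3^{-1},\ v_7=(x_3-1)y_3^{2}$; all other pairs of charts are disjoint in $P$. Let $\Theta_P=\mathcal Hom_{\mathcal O_P}(\Omega_{P/k},\mathcal O_P)$ be its tangent sheaf. Then $$H^1(P,\Theta_P)\neq 0 .$$ More precisely, $P$ is the union of the open subsets $U_0=(E_1\setminus E_2)\cup E_4\cup E_5$, $U_1=(E_1\setminus(E_4\cup E_5))\cup E_2\cup(E_3\setminus(E_6\cup E_7))$ and $U_2=(E_3\setminus E_2)\cup E_6\cup E_7$, with $U_0\cap U_2=\emptyset$, and the Čech $1$-cocycle $$\Big(0,\ x_3\frac{\partial}{\partial x_3}\Big)\in\Gamma(U_0\cap U_1,\Theta_P)\oplus\Gamma(U_1\cap U_2,\Theta_P)$$ of this cover (unique with these components) is not a Čech coboundary. -/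

import Mathlib

open CategoryTheory AlgebraicGeometry TopologicalSpace Opposite

universe u

namespace Tangent

noncomputable section

/-- The `k`-algebra structure on `Γ(X, V)` for a `k`-scheme `f : X ⟶ Spec k`. -/
@[reducible]
def sectionAlgebra {k : Type u} [Field k] {X : Scheme.{u}} (f : X ⟶ Spec (.of k)) (V : X.Opens) :
    Algebra k Γ(X, V) :=
  RingHom.toAlgebra ((X.presheaf.map (homOfLE le_top : V ⟶ ⊤).op).hom.comp
    (f.appTop.hom.comp (Scheme.ΓSpecIso (.of k)).inv.hom))

/-- Restriction of functions from `V` to `W ⊆ V`. -/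
def resFun {X : Scheme.{u}} {V W : X.Opens} (h : W ≤ V) : Γ(X, V) →+* Γ(X, W) :=
  (X.presheaf.map (homOfLE h).op).hom

/-- The module `Ω_{Γ(X, V)/k}` of Kähler differentials.  These modules form the presheaf of
`𝒪_X`-modules whose associated sheaf is `Ω_{X/k}`. -/
abbrev Kahler {k : Type u} [Field k] {X : Scheme.{u}} (f : X ⟶ Spec (.of k)) (V : X.Opens) :
    Type u :=
  letI := sectionAlgebra f V
  KaehlerDifferential k Γ(X, V)

/-- The universal derivation `d : Γ(X, V) → Ω_{Γ(X, V)/k}`. -/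
def dif {k : Type u} [Field k] {X : Scheme.{u}} (f : X ⟶ Spec (.of k)) (V : X.Opens)
    (a : Γ(X, V)) : Kahler f V :=
  letI := sectionAlgebra f V
  KaehlerDifferential.D k Γ(X, V) a

/-- `Γ(U, Θ_X)` for `Θ_X = ℋom(Ω_{X/k}, 𝒪_X)`: the homomorphisms of (pre)sheaves of modules
`Ω|_U → 𝒪|_U`, that is, families of `Γ(X, V)`-linear maps `Ω_{Γ(X, V)/k} → Γ(X, V)`, for `V ⊆ U`
open, that commute with restriction.  Since the exact differentials generate, it suffices to
require this on them; the restriction of `d a` to `W` is `d (a|_W)`. -/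
def tangentSections {k : Type u} [Field k] {X : Scheme.{u}} (f : X ⟶ Spec (.of k)) (U : X.Opens) :
    AddSubgroup (∀ V : {V : X.Opens // V ≤ U}, Kahler f V.1 →ₗ[Γ(X, V.1)] Γ(X, V.1)) where
  carrier := {φ | ∀ (V W : {V : X.Opens // V ≤ U}) (h : W.1 ≤ V.1) (a : Γ(X, V.1)),
    φ W (dif f W.1 (resFun h a)) = resFun h (φ V (dif f V.1 a))}
  zero_mem' := by intro V W h a; simp
  add_mem' := by
    intro φ ψ hφ hψ V W h a
    simp [hφ V W h a, hψ V W h a]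
  neg_mem' := by
    intro φ hφ V W h a
    simp [hφ V W h a]

/-- The restriction map `Γ(U, Θ_X) → Γ(U', Θ_X)`. -/
def tangentRes {k : Type u} [Field k] {X : Scheme.{u}} (f : X ⟶ Spec (.of k)) {U U' : X.Opens}
    (h : U' ≤ U) : tangentSections f U →+ tangentSections f U' where
  toFun φ := ⟨fun V => φ.1 ⟨V.1, V.2.trans h⟩, fun V W hVW a =>
    φ.2 ⟨V.1, V.2.trans h⟩ ⟨W.1, W.2.trans h⟩ hVW a⟩
  map_zero' := rfl
  map_add' _ _ := rfl

/-- The value `θ(a) = θ(d a)` of a vector field `θ ∈ Γ(U, Θ_X)` on a function `a` on `V ⊆ U`. -/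
def act {k : Type u} [Field k] {X : Scheme.{u}} {f : X ⟶ Spec (.of k)} {U : X.Opens}
    (θ : tangentSections f U) {V : X.Opens} (hV : V ≤ U) (a : Γ(X, V)) : Γ(X, V) :=
  θ.1 ⟨V, hV⟩ (dif f V a)

/-- The tangent sheaf as a presheaf of abelian groups. -/
def tangentPresheaf {k : Type u} [Field k] {X : Scheme.{u}} (f : X ⟶ Spec (.of k)) :
    TopCat.Presheaf AddCommGrpCat.{u} X where
  obj U := AddCommGrpCat.of (tangentSections f U.unop)
  map i := AddCommGrpCat.ofHom (tangentRes f i.unop.le)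
  map_id _ := rfl
  map_comp _ _ := rfl

section SheafProperty

variable {k : Type u} [Field k] {X : Scheme.{u}} {f : X ⟶ Spec (.of k)}

lemma resFun_resFun {V W Z : X.Opens} (h : W ≤ V) (h' : Z ≤ W) (a : Γ(X, V)) :
    resFun h' (resFun h a) = resFun (h'.trans h) a := by
  simp only [resFun, ← CommRingCat.comp_apply, ← Functor.map_comp]; rfl

lemma resFun_algebraMap {V W : X.Opens} (h : W ≤ V) (c : k) :
    resFun h ((sectionAlgebra f V).algebraMap c) = (sectionAlgebra f W).algebraMap c := by
  change resFun h (resFun le_top _) = resFun le_top _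
  rw [resFun_resFun]

lemma dif_add (V : X.Opens) (a b : Γ(X, V)) : dif f V (a + b) = dif f V a + dif f V b := by
  let := sectionAlgebra f V
  exact (KaehlerDifferential.D k Γ(X, V)).map_add a b

lemma dif_mul (V : X.Opens) (a b : Γ(X, V)) :
    dif f V (a * b) = a • dif f V b + b • dif f V a := by
  let := sectionAlgebra f V
  exact (KaehlerDifferential.D k Γ(X, V)).leibniz a b

lemma dif_algebraMap (V : X.Opens) (c : k) :
    dif f V ((sectionAlgebra f V).algebraMap c) = 0 := by
  let := sectionAlgebra f V
  exact (KaehlerDifferential.D k Γ(X, V)).map_algebraMap c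

lemma hom_ext (V : X.Opens) {φ ψ : Kahler f V →ₗ[Γ(X, V)] Γ(X, V)}
    (h : ∀ a, φ (dif f V a) = ψ (dif f V a)) : φ = ψ := by
  let := sectionAlgebra f V
  exact Derivation.liftKaehlerDifferential_unique _ _ (Derivation.ext h)

lemma fun_ext {ι : Type u} {V : X.Opens} {U : ι → X.Opens} (hV : V ≤ iSup U) {a b : Γ(X, V)}
    (h : ∀ i, resFun (inf_le_left : V ⊓ U i ≤ V) a = resFun inf_le_left b) : a = b := by
  refine X.sheaf.eq_of_locally_eq' (fun i => V ⊓ U i) V (fun i => homOfLE inf_le_left) ?_ a b h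
  rw [← inf_iSup_eq]
  exact le_inf le_rfl hV

lemma act_res {U V W : X.Opens} (θ : tangentSections f U) (hV : V ≤ U) (h : W ≤ V)
    (a : Γ(X, V)) : resFun h (act θ hV a) = act θ (h.trans hV) (resFun h a) :=
  (θ.2 ⟨V, hV⟩ ⟨W, h.trans hV⟩ h a).symm

lemma tangent_ext {U : X.Opens} {θ η : tangentSections f U}
    (h : ∀ (V : X.Opens) (hV : V ≤ U) (a : Γ(X, V)), act θ hV a = act η hV a) : θ = η := by
  apply Subtype.ext
  funext V
  exact hom_ext _ (h V.1 V.2)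

/-- The homomorphism `Ω_{Γ(X, V)/k} → Γ(X, V)` that belongs to a derivation of `Γ(X, V)`. -/
lemma exists_hom (V : X.Opens) (D : Γ(X, V) → Γ(X, V)) (hadd : ∀ a b, D (a + b) = D a + D b)
    (hmul : ∀ a b, D (a * b) = a * D b + b * D a)
    (hk : ∀ c : k, D ((sectionAlgebra f V).algebraMap c) = 0) :
    ∃ φ : Kahler f V →ₗ[Γ(X, V)] Γ(X, V), ∀ a, φ (dif f V a) = D a := by
  let := sectionAlgebra f V
  let D' : Derivation k Γ(X, V) Γ(X, V) := Derivation.mk' 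
    { toFun := D
      map_add' := hadd
      map_smul' := by
        intro c a
        simp only [Algebra.smul_def, RingHom.id_apply]
        rw [hmul, show D (algebraMap k _ c) = 0 from hk c]
        simp } (by intro a b; exact hmul a b)
  exact ⟨D'.liftKaehlerDifferential, fun a => D'.liftKaehlerDifferential_comp_D a⟩

lemma existsUnique_glue {ι : Type u} (U : ι → X.Opens) (s : ∀ i, tangentSections f (U i))
    (hs : ∀ i j, tangentRes f (inf_le_left : U i ⊓ U j ≤ U i) (s i) =
      tangentRes f inf_le_right (s j)) :
    ∃! θ : tangentSections f (iSup U), ∀ i, tangentRes f (le_iSup U i) θ = s i := by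
  have hs' : ∀ i j (W : X.Opens) (hi : W ≤ U i) (hj : W ≤ U j) (a : Γ(X, W)),
      act (s i) hi a = act (s j) hj a := fun i j W hi hj a =>
    congrArg (fun θ => act θ (le_inf hi hj) a) (hs i j)
  have key : ∀ (V : X.Opens) (hV : V ≤ iSup U) (a : Γ(X, V)), ∃ b : Γ(X, V), ∀ i,
      resFun (inf_le_left : V ⊓ U i ≤ V) b = act (s i) inf_le_right (resFun inf_le_left a) := by
    intro V hV a
    obtain ⟨b, hb, -⟩ := X.sheaf.existsUnique_gluing' (fun i => V ⊓ U i) V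
      (fun i => homOfLE inf_le_left) (by rw [← inf_iSup_eq]; exact le_inf le_rfl hV)
      (fun i => act (s i) inf_le_right (resFun (inf_le_left : V ⊓ U i ≤ V) a)) (by
        intro i j
        change resFun inf_le_left (act (s i) inf_le_right (resFun inf_le_left a)) =
          resFun inf_le_right (act (s j) inf_le_right (resFun inf_le_left a))
        rw [act_res, act_res, resFun_resFun, resFun_resFun]
        apply hs')
    exact ⟨b, hb⟩
  choose D hD using key
  have hφ : ∀ V : {V : X.Opens // V ≤ iSup U}, ∃ φ : Kahler f V.1 →ₗ[Γ(X, V.1)] Γ(X, V.1),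
      ∀ a, φ (dif f V.1 a) = D V.1 V.2 a := by
    intro V
    apply exists_hom
    · intro a b
      apply fun_ext V.2
      intro i
      simp only [map_add, hD, act, dif_add]
    · intro a b
      apply fun_ext V.2
      intro i
      simp only [map_add, map_mul, hD, act, dif_mul, map_smul, smul_eq_mul]
    · intro c
      apply fun_ext V.2
      intro i
      rw [hD, resFun_algebraMap (f := f)]
      simp only [act, dif_algebraMap, map_zero]
  choose φ hφ using hφ
  refine ⟨⟨φ, ?_⟩, ?_, ?_⟩
  · intro V W h a
    rw [hφ, hφ]
    apply fun_ext W.2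
    intro i
    have := congrArg (resFun (inf_le_inf_right (U i) h)) (hD V.1 V.2 a i)
    rw [act_res, resFun_resFun, resFun_resFun] at this
    rw [hD, resFun_resFun, resFun_resFun]
    exact this.symm
  · intro i
    apply tangent_ext
    intro V hV a
    change φ ⟨V, _⟩ (dif f V a) = _
    rw [hφ]
    apply fun_ext (hV.trans (le_iSup U i))
    intro j
    rw [hD, act_res]
    apply hs'
  · intro θ hθ
    apply tangent_ext
    intro V hV a
    change _ = φ ⟨V, _⟩ (dif f V a)
    rw [hφ]
    apply fun_ext hV
    intro i
    rw [hD, act_res, ← hθ i]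
    rfl

theorem isSheaf_tangentPresheaf (f : X ⟶ Spec (.of k)) : (tangentPresheaf f).IsSheaf := by
  apply (TopCat.Presheaf.isSheaf_iff_isSheafUniqueGluing _).2
  intro ι U s hs
  have h := existsUnique_glue (f := f) U (fun i => s i) (fun i j => hs i j)
  exact h

end SheafProperty

/-- The tangent sheaf `Θ_X = ℋom(Ω_{X/k}, 𝒪_X)` of a `k`-scheme `f : X ⟶ Spec k`. -/
def tangentSheaf {k : Type u} [Field k] {X : Scheme.{u}} (f : X ⟶ Spec (.of k)) :
    TopCat.Sheaf AddCommGrpCat.{u} X :=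
  ⟨tangentPresheaf f, isSheaf_tangentPresheaf f⟩

/-- The sheaf cohomology `H¹(X, Θ_X)`. -/
abbrev H1 {k : Type u} [Field k] {X : Scheme.{u}} (f : X ⟶ Spec (.of k)) : Type u :=
  CategoryTheory.Sheaf.H (J := Opens.grothendieckTopology X) (tangentSheaf f) 1

/-- A Čech 1-cochain of `Θ_X` with respect to the open sets `U i`. -/
abbrev CechCochain {k : Type u} [Field k] {X : Scheme.{u}} (f : X ⟶ Spec (.of k)) {ι : Type}
    (U : ι → X.Opens) : Type u :=
  ∀ i j, tangentSections f (U i ⊓ U j)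

/-- The cocycle condition `c_{ij} + c_{jl} = c_{il}` on `U i ∩ U j ∩ U l`. -/
def IsCechCocycle {k : Type u} [Field k] {X : Scheme.{u}} {f : X ⟶ Spec (.of k)} {ι : Type}
    {U : ι → X.Opens} (c : CechCochain f U) : Prop :=
  ∀ i j l,
    tangentRes f (show U i ⊓ U j ⊓ U l ≤ U i ⊓ U j from inf_le_left) (c i j) +
      tangentRes f (show U i ⊓ U j ⊓ U l ≤ U j ⊓ U l from inf_le_inf_right _ inf_le_right) (c j l) =
      tangentRes f (show U i ⊓ U j ⊓ U l ≤ U i ⊓ U l from inf_le_inf_right _ inf_le_left) (c i l)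

/-- `c` is a Čech coboundary: `c_{ij} = θ_j - θ_i` on `U i ∩ U j` for some `θ_i ∈ Γ(U i, Θ_X)`. -/
def IsCechCoboundary {k : Type u} [Field k] {X : Scheme.{u}} {f : X ⟶ Spec (.of k)} {ι : Type}
    {U : ι → X.Opens} (c : CechCochain f U) : Prop :=
  ∃ θ : ∀ i, tangentSections f (U i), ∀ i j,
    c i j = tangentRes f (show U i ⊓ U j ≤ U j from inf_le_right) (θ j) -
      tangentRes f (show U i ⊓ U j ≤ U i from inf_le_left) (θ i)

end

end Tangent

namespace Plumbing

noncomputable section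

/-- The ring `k[x, y, p⁻¹] / (f)`. -/
def ChartRing {k : Type u} [Field k] (f p : MvPolynomial (Fin 2) k) : Type u :=
  Localization.Away (Ideal.Quotient.mk (Ideal.span {f}) p)

namespace ChartRing

instance {k : Type u} [Field k] (f p : MvPolynomial (Fin 2) k) : CommRing (ChartRing f p) :=
  inferInstanceAs (CommRing (Localization.Away (Ideal.Quotient.mk (Ideal.span {f}) p)))

instance {k : Type u} [Field k] (f p : MvPolynomial (Fin 2) k) : Algebra k (ChartRing f p) :=
  inferInstanceAs (Algebra k (Localization.Away (Ideal.Quotient.mk (Ideal.span {f}) p)))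

instance {k : Type u} [Field k] (f p : MvPolynomial (Fin 2) k) :
    Algebra (MvPolynomial (Fin 2) k ⧸ Ideal.span {f}) (ChartRing f p) :=
  inferInstanceAs (Algebra _ (Localization.Away (Ideal.Quotient.mk (Ideal.span {f}) p)))

instance {k : Type u} [Field k] (f p : MvPolynomial (Fin 2) k) :
    IsScalarTower k (MvPolynomial (Fin 2) k ⧸ Ideal.span {f}) (ChartRing f p) :=
  inferInstanceAs
    (IsScalarTower k _ (Localization.Away (Ideal.Quotient.mk (Ideal.span {f}) p)))

instance {k : Type u} [Field k] (f p : MvPolynomial (Fin 2) k) :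
    IsLocalization.Away (Ideal.Quotient.mk (Ideal.span {f}) p) (ChartRing f p) :=
  inferInstanceAs
    (IsLocalization.Away _ (Localization.Away (Ideal.Quotient.mk (Ideal.span {f}) p)))

/-- The canonical map `k[x, y] → k[x, y, p⁻¹] / (f)`. -/
def mk {k : Type u} [Field k] (f p : MvPolynomial (Fin 2) k) :
    MvPolynomial (Fin 2) k →ₐ[k] ChartRing f p :=
  (IsScalarTower.toAlgHom k (MvPolynomial (Fin 2) k ⧸ Ideal.span {f}) (ChartRing f p)).comp
    (Ideal.Quotient.mkₐ k (Ideal.span {f}))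

/-- The coordinate function `x`. -/
def x {k : Type u} [Field k] (f p : MvPolynomial (Fin 2) k) : ChartRing f p :=
  mk f p (MvPolynomial.X 0)

/-- The coordinate function `y`. -/
def y {k : Type u} [Field k] (f p : MvPolynomial (Fin 2) k) : ChartRing f p :=
  mk f p (MvPolynomial.X 1)

variable {k : Type u} [Field k] {f p : MvPolynomial (Fin 2) k}

lemma mk_eq_aeval : mk f p = MvPolynomial.aeval ![x f p, y f p] := by
  apply MvPolynomial.algHom_ext
  intro i
  fin_cases i <;> simp [x, y]

lemma aeval_f : MvPolynomial.aeval ![x f p, y f p] f = 0 := by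
  rw [← mk_eq_aeval]
  change algebraMap (MvPolynomial (Fin 2) k ⧸ Ideal.span {f}) (ChartRing f p)
    (Ideal.Quotient.mk _ f) = 0
  rw [Ideal.Quotient.eq_zero_iff_mem.2 (Ideal.mem_span_singleton_self f), map_zero]

lemma isUnit_p : IsUnit (MvPolynomial.aeval ![x f p, y f p] p) := by
  rw [← mk_eq_aeval]
  exact IsLocalization.Away.algebraMap_isUnit (S := ChartRing f p)
    (Ideal.Quotient.mk (Ideal.span {f}) p)

variable {B : Type u} [CommRing B] [Algebra k B]

/-- The universal property of `k[x, y, p⁻¹] / (f)`. -/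
def lift (u v : B) (hf : MvPolynomial.aeval ![u, v] f = 0)
    (hp : IsUnit (MvPolynomial.aeval ![u, v] p)) : ChartRing f p →ₐ[k] B :=
  IsLocalization.liftAlgHom (M := Submonoid.powers (Ideal.Quotient.mk (Ideal.span {f}) p))
    (f := Ideal.Quotient.liftₐ (Ideal.span {f}) (MvPolynomial.aeval ![u, v]) (by
      intro a ha
      obtain ⟨b, rfl⟩ := Ideal.mem_span_singleton'.1 ha
      rw [map_mul, hf, mul_zero])) (by
    rintro ⟨_, n, rfl⟩
    rw [map_pow]
    exact hp.pow n)

lemma lift_mk (u v : B) (hf : MvPolynomial.aeval ![u, v] f = 0)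
    (hp : IsUnit (MvPolynomial.aeval ![u, v] p)) (a : MvPolynomial (Fin 2) k) :
    lift u v hf hp (mk f p a) = MvPolynomial.aeval ![u, v] a := by
  change IsLocalization.lift _ (algebraMap (MvPolynomial (Fin 2) k ⧸ Ideal.span {f})
    (ChartRing f p) (Ideal.Quotient.mk (Ideal.span {f}) a)) = _
  rw [IsLocalization.lift_eq]
  rfl

@[simp] lemma lift_x (u v : B) (hf : MvPolynomial.aeval ![u, v] f = 0)
    (hp : IsUnit (MvPolynomial.aeval ![u, v] p)) : lift u v hf hp (x f p) = u := by
  simp [x, lift_mk]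

@[simp] lemma lift_y (u v : B) (hf : MvPolynomial.aeval ![u, v] f = 0)
    (hp : IsUnit (MvPolynomial.aeval ![u, v] p)) : lift u v hf hp (y f p) = v := by
  simp [y, lift_mk]

lemma algHom_ext {φ ψ : ChartRing f p →ₐ[k] B} (hx : φ (x f p) = ψ (x f p))
    (hy : φ (y f p) = ψ (y f p)) : φ = ψ := by
  apply IsLocalization.algHom_ext (Submonoid.powers (Ideal.Quotient.mk (Ideal.span {f}) p))
    (A := MvPolynomial (Fin 2) k ⧸ Ideal.span {f})
  apply Ideal.Quotient.algHom_ext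
  apply MvPolynomial.algHom_ext
  intro i
  fin_cases i
  · exact hx
  · exact hy

end ChartRing
section Away

variable {k : Type u} [Field k] {A B : Type u} [CommRing A] [CommRing B] [Algebra k A]
  [Algebra k B]

/-- The inverse of `a` in `A[(a b)⁻¹]`. -/
def invLeft (a b : A) : Localization.Away (a * b) :=
  algebraMap A _ b * IsLocalization.Away.invSelf (a * b)

lemma mul_invLeft (a b : A) :
    algebraMap A (Localization.Away (a * b)) a * invLeft a b = 1 := by
  rw [invLeft, ← mul_assoc, ← map_mul, IsLocalization.Away.mul_invSelf]

lemma isUnit_left (a b : A) : IsUnit (algebraMap A (Localization.Away (a * b)) a) :=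
  IsUnit.of_mul_eq_one _ (mul_invLeft a b)

lemma isUnit_right (a b : A) : IsUnit (algebraMap A (Localization.Away (a * b)) b) := by
  have h := IsLocalization.Away.algebraMap_isUnit (S := Localization.Away (a * b)) (a * b)
  rw [map_mul] at h
  exact isUnit_of_mul_isUnit_right h

/-- The inverse of `a` in `A[a⁻¹]`. -/
def awayInv (a : A) : Localization.Away a := IsLocalization.Away.invSelf a

lemma mul_awayInv (a : A) : algebraMap A (Localization.Away a) a * awayInv a = 1 :=
  IsLocalization.Away.mul_invSelf a

/-- The extension of `φ` to `B[h⁻¹]`. -/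
def awayExt {C : Type u} [CommRing C] [Algebra k C] (h : B) (φ : B →ₐ[k] C) (hφ : IsUnit (φ h)) :
    Localization.Away h →ₐ[k] C :=
  IsLocalization.liftAlgHom (M := Submonoid.powers h) (f := φ) (by
    rintro ⟨_, n, rfl⟩
    rw [map_pow]
    exact hφ.pow n)

lemma awayExt_algebraMap {C : Type u} [CommRing C] [Algebra k C] (h : B) (φ : B →ₐ[k] C)
    (hφ : IsUnit (φ h)) (b : B) : awayExt h φ hφ (algebraMap B _ b) = φ b :=
  IsLocalization.lift_eq _ _

/-- If `φ : B → A[g⁻¹]` extends to an isomorphism `B[h⁻¹] ≃ A[g⁻¹]`, then it induces an open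
immersion. -/
lemma isOpenImmersion_of_inverse (g : A) (h : B) (φ : B →ₐ[k] Localization.Away g)
    (ψ : A →ₐ[k] Localization.Away h) (hφ : IsUnit (φ h)) (hψ : IsUnit (ψ g))
    (h₁ : (awayExt h φ hφ).comp ψ = IsScalarTower.toAlgHom k A (Localization.Away g))
    (h₂ : (awayExt g ψ hψ).comp φ = IsScalarTower.toAlgHom k B (Localization.Away h)) :
    IsOpenImmersion (Spec.map (CommRingCat.ofHom φ.toRingHom)) := by
  let e : Localization.Away h ≃ₐ[k] Localization.Away g :=
    AlgEquiv.ofAlgHom (awayExt h φ hφ) (awayExt g ψ hψ)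
      (by
        apply IsLocalization.algHom_ext (Submonoid.powers g) (A := A)
        ext a
        change awayExt h φ hφ (awayExt g ψ hψ (algebraMap A _ a)) = algebraMap A _ a
        rw [awayExt_algebraMap]
        exact DFunLike.congr_fun h₁ a)
      (by
        apply IsLocalization.algHom_ext (Submonoid.powers h) (A := B)
        ext a
        change awayExt g ψ hψ (awayExt h φ hφ (algebraMap B _ a)) = algebraMap B _ a
        rw [awayExt_algebraMap]
        exact DFunLike.congr_fun h₂ a)
  let E : CommRingCat.of (Localization.Away h) ≅ CommRingCat.of (Localization.Away g) :=
    e.toRingEquiv.toCommRingCatIso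
  have hE : CommRingCat.ofHom φ.toRingHom =
      CommRingCat.ofHom (algebraMap B (Localization.Away h)) ≫ E.hom := by
    ext b
    exact (awayExt_algebraMap h φ hφ b).symm
  rw [hE, Spec.map_comp]
  have : IsOpenImmersion (Spec.map (CommRingCat.ofHom (algebraMap B (Localization.Away h)))) :=
    inferInstance
  infer_instance

/-- The localization map as a `k`-algebra homomorphism. -/
def loc (g : A) : A →ₐ[k] Localization.Away g :=
  IsScalarTower.toAlgHom k A (Localization.Away g)

lemma loc_apply (g a : A) : loc (k := k) g a = algebraMap A _ a := rfl

/-- A coordinate change `u = U⁻¹`, `v = V U ^ b` is an open immersion. -/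
lemma isOpenImmersion_coordChange (g U V : A) (u v : B) (b : ℕ) (i : Localization.Away g)
    (φ : B →ₐ[k] Localization.Away g) (ψ : A →ₐ[k] Localization.Away u)
    (hU : loc (k := k) g U * i = 1) (hψ : IsUnit (ψ g)) (φu : φ u = i)
    (φv : φ v = loc (k := k) g V * loc (k := k) g U ^ b) (ψU : ψ U = awayInv u)
    (ψV : ψ V = loc (k := k) u v * loc (k := k) u u ^ b)
    (extA : ∀ α β : A →ₐ[k] Localization.Away g, α U = β U → α V = β V → α = β)
    (extB : ∀ α β : B →ₐ[k] Localization.Away u, α u = β u → α v = β v → α = β) :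
    IsOpenImmersion (Spec.map (CommRingCat.ofHom φ.toRingHom)) := by
  have hφ : IsUnit (φ u) := by rw [φu]; exact IsUnit.of_mul_eq_one_right _ hU
  have h1 : awayExt u φ hφ (awayInv u) = loc (k := k) g U := by
    have h := congrArg (awayExt u φ hφ) (mul_awayInv u)
    rw [map_mul, map_one, awayExt_algebraMap, φu] at h
    exact left_inv_eq_right_inv (by rw [mul_comm]; exact h) (by rw [mul_comm]; exact hU)
  have h2 : awayExt g ψ hψ i = loc (k := k) u u := by
    have h := congrArg (awayExt g ψ hψ) hU
    rw [map_mul, map_one, loc_apply, awayExt_algebraMap, ψU] at h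
    exact left_inv_eq_right_inv (by rw [mul_comm]; exact h) (by rw [mul_comm]; exact mul_awayInv u)
  refine isOpenImmersion_of_inverse g u φ ψ hφ hψ (extA _ _ ?_ ?_) (extB _ _ ?_ ?_)
  · change awayExt u φ hφ (ψ U) = loc (k := k) g U
    rw [ψU, h1]
  · change awayExt u φ hφ (ψ V) = loc (k := k) g V
    rw [ψV, map_mul, map_pow, loc_apply, loc_apply, awayExt_algebraMap, awayExt_algebraMap, φv,
      φu, mul_assoc, ← mul_pow, hU, one_pow, mul_one]
  · change awayExt g ψ hψ (φ u) = loc (k := k) u u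
    rw [φu, h2]
  · change awayExt g ψ hψ (φ v) = loc (k := k) u v
    rw [φv, map_mul, map_pow, loc_apply, loc_apply, awayExt_algebraMap, awayExt_algebraMap, ψU,
      ψV, mul_assoc, ← mul_pow, loc_apply, loc_apply, mul_awayInv, one_pow, mul_one]

lemma eq_zero_of_unit {a b : A} (ha : IsUnit a) (h : a * b = 0) : b = 0 :=
  (ha.mul_right_eq_zero).1 h

end Away

section Charts

open MvPolynomial

/-- The affine charts: `left` and `right` are neighbourhoods of `E₁ ∖ E₂` and `E₃ ∖ E₂`, `mid₁` and
`mid₂` neighbourhoods of the points `E₁ ∩ E₂` and `E₂ ∩ E₃`, and `e₄`, …, `e₇` are neighbourhoods of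
`E₄ ∖ E₁`, `E₅ ∖ E₁`, `E₆ ∖ E₃`, `E₇ ∖ E₃`. -/
inductive Chart : Type
  | left | mid₁ | mid₂ | right | e₄ | e₅ | e₆ | e₇

/-- The pairs of charts that meet. -/
inductive Overlap : Type
  | left_e₄ | left_e₅ | left_mid₁ | mid₁_mid₂ | right_mid₂ | right_e₆ | right_e₇

/-- The equation `f` of the chart `Spec k[x, y, p⁻¹] / (f)`.  The multiplicity of `E_i` is
`ν (i - 1)`. -/
def chartEq (k : Type u) [Field k] (ν : Fin 7 → ℕ) : Chart → MvPolynomial (Fin 2) k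
  | .left => (X 0 - 1) ^ ν 4 * X 0 ^ ν 3 * X 1 ^ ν 0
  | .mid₁ => X 0 ^ ν 1 * X 1 ^ ν 0
  | .mid₂ => X 0 ^ ν 2 * X 1 ^ ν 1
  | .right => (X 0 - 1) ^ ν 6 * X 0 ^ ν 5 * X 1 ^ ν 2
  | .e₄ => X 1 ^ ν 3
  | .e₅ => X 1 ^ ν 4
  | .e₆ => X 1 ^ ν 5
  | .e₇ => X 1 ^ ν 6

/-- The function `p` that is inverted in the chart `Spec k[x, y, p⁻¹] / (f)`. -/
def chartInv (k : Type u) [Field k] : Chart → MvPolynomial (Fin 2) k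
  | .mid₁ => 1 - X 0
  | .mid₂ => 1 - X 1
  | _ => 1

/-- The coordinate ring of a chart. -/
abbrev CoordRing (k : Type u) [Field k] (ν : Fin 7 → ℕ) (c : Chart) : Type u :=
  ChartRing (chartEq k ν c) (chartInv k c)

/-- The coordinate function `x` of a chart. -/
abbrev cx (k : Type u) [Field k] (ν : Fin 7 → ℕ) (c : Chart) : CoordRing k ν c := ChartRing.x _ _

/-- The coordinate function `y` of a chart. -/
abbrev cy (k : Type u) [Field k] (ν : Fin 7 → ℕ) (c : Chart) : CoordRing k ν c := ChartRing.y _ _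

/-- The first chart of an overlap. -/
abbrev src : Overlap → Chart
  | .left_e₄ => .left
  | .left_e₅ => .left
  | .left_mid₁ => .left
  | .mid₁_mid₂ => .mid₁
  | .right_mid₂ => .right
  | .right_e₆ => .right
  | .right_e₇ => .right

/-- The second chart of an overlap. -/
abbrev tgt : Overlap → Chart
  | .left_e₄ => .e₄
  | .left_e₅ => .e₅
  | .left_mid₁ => .mid₁
  | .mid₁_mid₂ => .mid₂
  | .right_mid₂ => .mid₂
  | .right_e₆ => .e₆
  | .right_e₇ => .e₇

/-- The overlap is the locus in the first chart where this function is invertible. -/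
abbrev srcFun (k : Type u) [Field k] (ν : Fin 7 → ℕ) : (o : Overlap) → CoordRing k ν (src o)
  | .left_e₄ => cy k ν .left * (cx k ν .left - 1)
  | .left_e₅ => cy k ν .left * cx k ν .left
  | .left_mid₁ => cx k ν .left * (cx k ν .left - 1)
  | .mid₁_mid₂ => cy k ν .mid₁
  | .right_mid₂ => cx k ν .right * (cx k ν .right - 1)
  | .right_e₆ => cy k ν .right * (cx k ν .right - 1)
  | .right_e₇ => cy k ν .right * cx k ν .right

/-- The overlap is the locus in the second chart where this function is invertible. -/
abbrev tgtFun (k : Type u) [Field k] (ν : Fin 7 → ℕ) : (o : Overlap) → CoordRing k ν (tgt o)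
  | .left_e₄ => cx k ν .e₄
  | .left_e₅ => cx k ν .e₅
  | .left_mid₁ => cx k ν .mid₁
  | .mid₁_mid₂ => cx k ν .mid₂
  | .right_mid₂ => cy k ν .mid₂
  | .right_e₆ => cx k ν .e₆
  | .right_e₇ => cx k ν .e₇

/-- The coordinate ring of an overlap. -/
abbrev OverlapRing (k : Type u) [Field k] (ν : Fin 7 → ℕ) (o : Overlap) : Type u :=
  Localization.Away (srcFun k ν o)

variable {k : Type u} [Field k]

/-! ### The ring homomorphisms of the coordinate changes -/

section Blocks

variable {f p : MvPolynomial (Fin 2) k} {n m l : ℕ}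

lemma rel_left {C : Type u} [CommRing C] [Algebra k C]
    (φ : ChartRing ((X 0 - 1) ^ n * X 0 ^ m * X 1 ^ l : MvPolynomial (Fin 2) k) p →ₐ[k] C) :
    (φ (ChartRing.x _ _) - 1) ^ n * φ (ChartRing.x _ _) ^ m * φ (ChartRing.y _ _) ^ l = 0 := by
  have h := congrArg φ (ChartRing.aeval_f (k := k)
    (f := (X 0 - 1) ^ n * X 0 ^ m * X 1 ^ l) (p := p))
  simpa using h

lemma rel_mid {C : Type u} [CommRing C] [Algebra k C]
    (φ : ChartRing (X 0 ^ m * X 1 ^ l : MvPolynomial (Fin 2) k) p →ₐ[k] C) :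
    φ (ChartRing.x _ _) ^ m * φ (ChartRing.y _ _) ^ l = 0 := by
  have h := congrArg φ (ChartRing.aeval_f (k := k) (f := X 0 ^ m * X 1 ^ l) (p := p))
  simpa using h

lemma rel_leaf {C : Type u} [CommRing C] [Algebra k C]
    (φ : ChartRing (X 1 ^ l : MvPolynomial (Fin 2) k) p →ₐ[k] C) :
    φ (ChartRing.y _ _) ^ l = 0 := by
  have h := congrArg φ (ChartRing.aeval_f (k := k) (f := X 1 ^ l) (p := p))
  simpa using h

/-- The ring of the charts `left` and `right`. -/
abbrev SideRing (k : Type u) [Field k] (n m l : ℕ) : Type u :=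
  ChartRing ((X 0 - 1) ^ n * X 0 ^ m * X 1 ^ l : MvPolynomial (Fin 2) k) 1

/-- The ring of the charts `e₄`, …, `e₇`. -/
abbrev LeafRing (k : Type u) [Field k] (m : ℕ) : Type u :=
  ChartRing (X 1 ^ m : MvPolynomial (Fin 2) k) 1

/-- The ring of the charts `mid₁` (with `p = 1 - x`) and `mid₂` (with `p = 1 - y`). -/
abbrev MidRing (k : Type u) [Field k] (p : MvPolynomial (Fin 2) k) (m l : ℕ) : Type u :=
  ChartRing (X 0 ^ m * X 1 ^ l : MvPolynomial (Fin 2) k) p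

/-- The coordinate change `x' = y⁻¹`, `y' = x y ^ b`, where `x'`, `y'` are the coordinates of a
leaf. -/
def leafTrans₀ (k : Type u) [Field k] (n m l b : ℕ) : LeafRing k m →ₐ[k]
    Localization.Away ((ChartRing.y _ _ * (ChartRing.x _ _ - 1) : SideRing k n m l)) :=
  ChartRing.lift (invLeft _ _)
    (loc (k := k) _ (ChartRing.x _ _) * loc (k := k) _ (ChartRing.y _ _) ^ b)
    (by
      have h := rel_left (loc ((ChartRing.y _ _ * (ChartRing.x _ _ - 1) : SideRing k n m l)))
      have hy := isUnit_left (ChartRing.y _ _) (ChartRing.x _ _ - 1 : SideRing k n m l)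
      have hx := isUnit_right (ChartRing.y _ _) (ChartRing.x _ _ - 1 : SideRing k n m l)
      rw [map_sub, map_one] at hx
      have h' : loc (k := k) (ChartRing.y _ _ * (ChartRing.x _ _ - 1) : SideRing k n m l)
          (ChartRing.x _ _) ^ m = 0 :=
        eq_zero_of_unit ((hx.pow n).mul (hy.pow l)) (by
          simp only [loc_apply] at h ⊢
          linear_combination h)
      rw [map_pow, MvPolynomial.aeval_X]
      change (_ * _) ^ m = 0
      rw [mul_pow, h', zero_mul])
    (by simp)

lemma leafTrans₀_unit (n m l b : ℕ) : IsUnit (leafTrans₀ k n m l b (ChartRing.x _ _)) := by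
  rw [leafTrans₀, ChartRing.lift_x]
  exact IsUnit.of_mul_eq_one_right _ (mul_invLeft _ _)

lemma leafTrans₀_open (n m l b : ℕ) :
    IsOpenImmersion (Spec.map (CommRingCat.ofHom (leafTrans₀ k n m l b).toRingHom)) := by
  have h0 : loc (k := k) (ChartRing.x _ _ : LeafRing k m) (ChartRing.y _ _) ^ m = 0 :=
    rel_leaf (loc (ChartRing.x _ _ : LeafRing k m))
  let ψ : SideRing k n m l →ₐ[k] Localization.Away (ChartRing.x _ _ : LeafRing k m) :=
    ChartRing.lift (loc (k := k) _ (ChartRing.y _ _) * loc (k := k) _ (ChartRing.x _ _) ^ b)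
      (awayInv _) (by
        simp only [map_mul, map_pow, MvPolynomial.aeval_X]
        change _ * (_ * _) ^ m * _ = _
        rw [mul_pow, h0]
        ring) (by simp)
  refine isOpenImmersion_coordChange _ (ChartRing.y _ _) (ChartRing.x _ _) (ChartRing.x _ _)
    (ChartRing.y _ _) b (invLeft _ _) _ ψ (mul_invLeft _ _) ?_ (ChartRing.lift_x _ _ _ _)
    (ChartRing.lift_y _ _ _ _) (ChartRing.lift_y _ _ _ _) (ChartRing.lift_x _ _ _ _)
    (fun _ _ h h' => ChartRing.algHom_ext h' h) (fun _ _ h h' => ChartRing.algHom_ext h h')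
  rw [map_mul, map_sub, map_one]
  simp only [ψ, ChartRing.lift_x, ChartRing.lift_y]
  refine (IsUnit.of_mul_eq_one_right _ (mul_awayInv _)).mul ?_
  apply IsNilpotent.isUnit_sub_one
  exact ⟨m, by rw [mul_pow, h0, zero_mul]⟩

/-- The coordinate change `x' = y⁻¹`, `y' = (x - 1) y ^ b`, where `x'`, `y'` are the coordinates of a
leaf. -/
def leafTrans₁ (k : Type u) [Field k] (n m l b : ℕ) : LeafRing k n →ₐ[k]
    Localization.Away ((ChartRing.y _ _ * ChartRing.x _ _ : SideRing k n m l)) :=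
  ChartRing.lift (invLeft _ _)
    (loc (k := k) _ (ChartRing.x _ _ - 1) * loc (k := k) _ (ChartRing.y _ _) ^ b)
    (by
      have h := rel_left (loc ((ChartRing.y _ _ * ChartRing.x _ _ : SideRing k n m l)))
      have hy := isUnit_left (ChartRing.y _ _) (ChartRing.x _ _ : SideRing k n m l)
      have hx := isUnit_right (ChartRing.y _ _) (ChartRing.x _ _ : SideRing k n m l)
      have h' : loc (k := k) (ChartRing.y _ _ * ChartRing.x _ _ : SideRing k n m l)
          (ChartRing.x _ _ - 1) ^ n = 0 :=
        eq_zero_of_unit ((hx.pow m).mul (hy.pow l)) (by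
          simp only [loc_apply, map_sub, map_one] at h ⊢
          linear_combination h)
      rw [map_pow, MvPolynomial.aeval_X]
      change (_ * _) ^ n = 0
      rw [mul_pow, h', zero_mul])
    (by simp)

lemma leafTrans₁_unit (n m l b : ℕ) : IsUnit (leafTrans₁ k n m l b (ChartRing.x _ _)) := by
  rw [leafTrans₁, ChartRing.lift_x]
  exact IsUnit.of_mul_eq_one_right _ (mul_invLeft _ _)

lemma leafTrans₁_open (n m l b : ℕ) :
    IsOpenImmersion (Spec.map (CommRingCat.ofHom (leafTrans₁ k n m l b).toRingHom)) := by
  have h0 : loc (k := k) (ChartRing.x _ _ : LeafRing k n) (ChartRing.y _ _) ^ n = 0 :=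
    rel_leaf (loc (ChartRing.x _ _ : LeafRing k n))
  let ψ : SideRing k n m l →ₐ[k] Localization.Away (ChartRing.x _ _ : LeafRing k n) :=
    ChartRing.lift (1 + loc (k := k) _ (ChartRing.y _ _) * loc (k := k) _ (ChartRing.x _ _) ^ b)
      (awayInv _) (by
        simp only [map_mul, map_pow, map_sub, map_one, MvPolynomial.aeval_X]
        change (1 + _ * _ - 1) ^ n * _ * _ = _
        rw [add_sub_cancel_left, mul_pow, h0]
        ring) (by simp)
  refine isOpenImmersion_coordChange _ (ChartRing.y _ _) (ChartRing.x _ _ - 1) (ChartRing.x _ _)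
    (ChartRing.y _ _) b (invLeft _ _) _ ψ (mul_invLeft _ _) ?_ (ChartRing.lift_x _ _ _ _)
    (ChartRing.lift_y _ _ _ _) (ChartRing.lift_y _ _ _ _) (by simp [ψ])
    (fun _ _ h h' => ChartRing.algHom_ext (by simpa using h') h) (fun _ _ h h' => ChartRing.algHom_ext h h')
  rw [map_mul]
  simp only [ψ, ChartRing.lift_x, ChartRing.lift_y]
  refine (IsUnit.of_mul_eq_one_right _ (mul_awayInv _)).mul ?_
  apply IsNilpotent.isUnit_one_add
  exact ⟨n, by rw [mul_pow, h0, zero_mul]⟩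

lemma rel_side₂ (n m l : ℕ) :
    loc (k := k) (ChartRing.x _ _ * (ChartRing.x _ _ - 1) : SideRing k n m l)
      (ChartRing.y _ _) ^ l = 0 := by
  have h := rel_left (loc ((ChartRing.x _ _ * (ChartRing.x _ _ - 1) : SideRing k n m l)))
  have hy := isUnit_left (ChartRing.x _ _) (ChartRing.x _ _ - 1 : SideRing k n m l)
  have hx := isUnit_right (ChartRing.x _ _) (ChartRing.x _ _ - 1 : SideRing k n m l)
  rw [map_sub, map_one] at hx
  refine eq_zero_of_unit ((hx.pow n).mul (hy.pow m)) ?_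
  simp only [loc_apply] at h ⊢
  linear_combination h

lemma isUnit_one_sub_invLeft (n m l : ℕ) :
    IsUnit (1 - invLeft (ChartRing.x _ _) (ChartRing.x _ _ - 1 : SideRing k n m l)) := by
  have h := mul_invLeft (ChartRing.x _ _) (ChartRing.x _ _ - 1 : SideRing k n m l)
  have hx := isUnit_right (ChartRing.x _ _) (ChartRing.x _ _ - 1 : SideRing k n m l)
  rw [map_sub, map_one] at hx
  have h1 : 1 - invLeft (ChartRing.x _ _) (ChartRing.x _ _ - 1 : SideRing k n m l) =
      invLeft (ChartRing.x _ _) (ChartRing.x _ _ - 1 : SideRing k n m l) *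
        (algebraMap (SideRing k n m l) _ (ChartRing.x _ _) - 1) := by
    linear_combination -h
  rw [h1]
  exact (IsUnit.of_mul_eq_one_right _ h).mul hx

/-- The coordinate change `x' = x⁻¹`, `y' = y x ^ b` at the point `x = ∞`. -/
def endTrans₁ (k : Type u) [Field k] (n m l q b : ℕ) : MidRing k (1 - X 0) q l →ₐ[k]
    Localization.Away ((ChartRing.x _ _ * (ChartRing.x _ _ - 1) : SideRing k n m l)) :=
  ChartRing.lift (invLeft _ _)
    (loc (k := k) _ (ChartRing.y _ _) * loc (k := k) _ (ChartRing.x _ _) ^ b)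
    (by
      have h' := rel_side₂ (k := k) n m l
      simp only [map_mul, map_pow, MvPolynomial.aeval_X]
      change _ * (_ * _) ^ l = 0
      rw [mul_pow, h']
      ring)
    (by simpa using isUnit_one_sub_invLeft (k := k) n m l)

lemma endTrans₁_unit (n m l q b : ℕ) : IsUnit (endTrans₁ k n m l q b (ChartRing.x _ _)) := by
  rw [endTrans₁, ChartRing.lift_x]
  exact IsUnit.of_mul_eq_one_right _ (mul_invLeft _ _)

lemma endTrans₁_open (n m l q b : ℕ) :
    IsOpenImmersion (Spec.map (CommRingCat.ofHom (endTrans₁ k n m l q b).toRingHom)) := by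
  have hx : IsUnit (loc (k := k) (ChartRing.x _ _ : MidRing k (1 - X 0) q l) (ChartRing.x _ _)) :=
    IsUnit.of_mul_eq_one _ (mul_awayInv _)
  have h0 : loc (k := k) (ChartRing.x _ _ : MidRing k (1 - X 0) q l) (ChartRing.y _ _) ^ l = 0 :=
    eq_zero_of_unit (hx.pow q) (rel_mid (loc (k := k) (ChartRing.x _ _ : MidRing k (1 - X 0) q l)))
  let ψ : SideRing k n m l →ₐ[k] Localization.Away (ChartRing.x _ _ : MidRing k (1 - X 0) q l) :=
    ChartRing.lift (awayInv _)
      (loc (k := k) _ (ChartRing.y _ _) * loc (k := k) _ (ChartRing.x _ _) ^ b) (by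
        simp only [map_mul, map_pow, MvPolynomial.aeval_X]
        change _ * (_ * _) ^ l = _
        rw [mul_pow, h0]
        ring) (by simp)
  refine isOpenImmersion_coordChange _ (ChartRing.x _ _) (ChartRing.y _ _) (ChartRing.x _ _)
    (ChartRing.y _ _) b (invLeft _ _) _ ψ (mul_invLeft _ _) ?_ (ChartRing.lift_x _ _ _ _)
    (ChartRing.lift_y _ _ _ _) (ChartRing.lift_x _ _ _ _) (ChartRing.lift_y _ _ _ _)
    (fun _ _ h h' => ChartRing.algHom_ext h h') (fun _ _ h h' => ChartRing.algHom_ext h h')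
  rw [map_mul, map_sub, map_one]
  simp only [ψ, ChartRing.lift_x]
  have hi : IsUnit (awayInv (ChartRing.x _ _ : MidRing k (1 - X 0) q l)) :=
    IsUnit.of_mul_eq_one_right _ (mul_awayInv _)
  have hp : IsUnit (1 - loc (k := k) (ChartRing.x _ _ : MidRing k (1 - X 0) q l)
      (ChartRing.x _ _)) := by
    have h := (ChartRing.isUnit_p (k := k) (f := X 0 ^ q * X 1 ^ l) (p := 1 - X 0)).map
      (loc (k := k) (ChartRing.x _ _ : MidRing k (1 - X 0) q l))
    simpa using h
  refine hi.mul ?_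
  have h1 : awayInv (ChartRing.x _ _ : MidRing k (1 - X 0) q l) - 1 =
      awayInv (ChartRing.x _ _ : MidRing k (1 - X 0) q l) *
        (1 - loc (k := k) (ChartRing.x _ _ : MidRing k (1 - X 0) q l) (ChartRing.x _ _)) := by
    have h := mul_awayInv (ChartRing.x _ _ : MidRing k (1 - X 0) q l)
    rw [loc_apply]
    linear_combination h
  rw [h1]
  exact hi.mul hp

/-- The coordinate change `y' = x⁻¹`, `x' = y x ^ b` at the point `x = ∞`. -/
def endTrans₂ (k : Type u) [Field k] (n m l q b : ℕ) : MidRing k (1 - X 1) l q →ₐ[k]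
    Localization.Away ((ChartRing.x _ _ * (ChartRing.x _ _ - 1) : SideRing k n m l)) :=
  ChartRing.lift
    (loc (k := k) _ (ChartRing.y _ _) * loc (k := k) _ (ChartRing.x _ _) ^ b) (invLeft _ _)
    (by
      have h' := rel_side₂ (k := k) n m l
      simp only [map_mul, map_pow, MvPolynomial.aeval_X]
      change (_ * _) ^ l * _ = 0
      rw [mul_pow, h']
      ring)
    (by simpa using isUnit_one_sub_invLeft (k := k) n m l)

lemma endTrans₂_unit (n m l q b : ℕ) : IsUnit (endTrans₂ k n m l q b (ChartRing.y _ _)) := by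
  rw [endTrans₂, ChartRing.lift_y]
  exact IsUnit.of_mul_eq_one_right _ (mul_invLeft _ _)

lemma endTrans₂_open (n m l q b : ℕ) :
    IsOpenImmersion (Spec.map (CommRingCat.ofHom (endTrans₂ k n m l q b).toRingHom)) := by
  have hx : IsUnit (loc (k := k) (ChartRing.y _ _ : MidRing k (1 - X 1) l q) (ChartRing.y _ _)) :=
    IsUnit.of_mul_eq_one _ (mul_awayInv _)
  have h0 : loc (k := k) (ChartRing.y _ _ : MidRing k (1 - X 1) l q) (ChartRing.x _ _) ^ l = 0 :=
    eq_zero_of_unit (hx.pow q) ((mul_comm _ _).trans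
      (rel_mid (loc (k := k) (ChartRing.y _ _ : MidRing k (1 - X 1) l q))))
  let ψ : SideRing k n m l →ₐ[k] Localization.Away (ChartRing.y _ _ : MidRing k (1 - X 1) l q) :=
    ChartRing.lift (awayInv _)
      (loc (k := k) _ (ChartRing.x _ _) * loc (k := k) _ (ChartRing.y _ _) ^ b) (by
        simp only [map_mul, map_pow, MvPolynomial.aeval_X]
        change _ * (_ * _) ^ l = _
        rw [mul_pow, h0]
        ring) (by simp)
  refine isOpenImmersion_coordChange _ (ChartRing.x _ _) (ChartRing.y _ _) (ChartRing.y _ _)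
    (ChartRing.x _ _) b (invLeft _ _) _ ψ (mul_invLeft _ _) ?_ (ChartRing.lift_y _ _ _ _)
    (ChartRing.lift_x _ _ _ _) (ChartRing.lift_x _ _ _ _) (ChartRing.lift_y _ _ _ _)
    (fun _ _ h h' => ChartRing.algHom_ext h h') (fun _ _ h h' => ChartRing.algHom_ext h' h)
  rw [map_mul, map_sub, map_one]
  simp only [ψ, ChartRing.lift_x]
  have hi : IsUnit (awayInv (ChartRing.y _ _ : MidRing k (1 - X 1) l q)) :=
    IsUnit.of_mul_eq_one_right _ (mul_awayInv _)
  have hp : IsUnit (1 - loc (k := k) (ChartRing.y _ _ : MidRing k (1 - X 1) l q)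
      (ChartRing.y _ _)) := by
    have h := (ChartRing.isUnit_p (k := k) (f := X 0 ^ l * X 1 ^ q) (p := 1 - X 1)).map
      (loc (k := k) (ChartRing.y _ _ : MidRing k (1 - X 1) l q))
    simpa using h
  refine hi.mul ?_
  have h1 : awayInv (ChartRing.y _ _ : MidRing k (1 - X 1) l q) - 1 =
      awayInv (ChartRing.y _ _ : MidRing k (1 - X 1) l q) *
        (1 - loc (k := k) (ChartRing.y _ _ : MidRing k (1 - X 1) l q) (ChartRing.y _ _)) := by
    have h := mul_awayInv (ChartRing.y _ _ : MidRing k (1 - X 1) l q)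
    rw [loc_apply]
    linear_combination h
  rw [h1]
  exact hi.mul hp

lemma rel_mid₁ (q l : ℕ) :
    loc (k := k) (ChartRing.y _ _ : MidRing k (1 - X 0) q l) (ChartRing.x _ _) ^ q = 0 := by
  have hy : IsUnit (loc (k := k) (ChartRing.y _ _ : MidRing k (1 - X 0) q l) (ChartRing.y _ _)) :=
    IsUnit.of_mul_eq_one _ (mul_awayInv _)
  refine eq_zero_of_unit (hy.pow l) ?_
  exact (mul_comm _ _).trans (rel_mid (loc (ChartRing.y _ _ : MidRing k (1 - X 0) q l)))

/-- The coordinate change `x' = y⁻¹`, `y' = x y ^ b` between `mid₁` and `mid₂`. -/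
def midTrans (k : Type u) [Field k] (q l r b : ℕ) : MidRing k (1 - X 1) r q →ₐ[k]
    Localization.Away (ChartRing.y _ _ : MidRing k (1 - X 0) q l) :=
  ChartRing.lift (awayInv _)
    (loc (k := k) _ (ChartRing.x _ _) * loc (k := k) _ (ChartRing.y _ _) ^ b)
    (by
      have h' := rel_mid₁ (k := k) q l
      simp only [map_mul, map_pow, MvPolynomial.aeval_X]
      change _ * (_ * _) ^ q = 0
      rw [mul_pow, h']
      ring)
    (by
      have h' := rel_mid₁ (k := k) q l
      simp only [map_sub, map_one, MvPolynomial.aeval_X]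
      apply IsNilpotent.isUnit_one_sub
      refine ⟨q, ?_⟩
      change (_ * _) ^ q = 0
      rw [mul_pow, h', zero_mul])

lemma midTrans_unit (q l r b : ℕ) : IsUnit (midTrans k q l r b (ChartRing.x _ _)) := by
  rw [midTrans, ChartRing.lift_x]
  exact IsUnit.of_mul_eq_one_right _ (mul_awayInv _)

lemma midTrans_open (q l r b : ℕ) :
    IsOpenImmersion (Spec.map (CommRingCat.ofHom (midTrans k q l r b).toRingHom)) := by
  have hx : IsUnit (loc (k := k) (ChartRing.x _ _ : MidRing k (1 - X 1) r q) (ChartRing.x _ _)) :=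
    IsUnit.of_mul_eq_one _ (mul_awayInv _)
  have h0 : loc (k := k) (ChartRing.x _ _ : MidRing k (1 - X 1) r q) (ChartRing.y _ _) ^ q = 0 :=
    eq_zero_of_unit (hx.pow r) (rel_mid (loc (k := k) (ChartRing.x _ _ : MidRing k (1 - X 1) r q)))
  let ψ : MidRing k (1 - X 0) q l →ₐ[k]
      Localization.Away (ChartRing.x _ _ : MidRing k (1 - X 1) r q) :=
    ChartRing.lift (loc (k := k) _ (ChartRing.y _ _) * loc (k := k) _ (ChartRing.x _ _) ^ b)
      (awayInv _) (by
        simp only [map_mul, map_pow, MvPolynomial.aeval_X]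
        change (_ * _) ^ q * _ = _
        rw [mul_pow, h0]
        ring) (by
        simp only [map_sub, map_one, MvPolynomial.aeval_X]
        apply IsNilpotent.isUnit_one_sub
        refine ⟨q, ?_⟩
        change (_ * _) ^ q = 0
        rw [mul_pow, h0, zero_mul])
  refine isOpenImmersion_coordChange _ (ChartRing.y _ _) (ChartRing.x _ _) (ChartRing.x _ _)
    (ChartRing.y _ _) b (awayInv _) _ ψ (mul_awayInv _) ?_ (ChartRing.lift_x _ _ _ _)
    (ChartRing.lift_y _ _ _ _) (ChartRing.lift_y _ _ _ _) (ChartRing.lift_x _ _ _ _)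
    (fun _ _ h h' => ChartRing.algHom_ext h' h) (fun _ _ h h' => ChartRing.algHom_ext h h')
  simp only [ψ, ChartRing.lift_y]
  exact IsUnit.of_mul_eq_one_right _ (mul_awayInv _)

end Blocks
/-- The coordinate changes.  `E_i` has self-intersection number `- b (i - 1)`. -/
def transition (k : Type u) [Field k] (b ν : Fin 7 → ℕ) :
    (o : Overlap) → (CoordRing k ν (tgt o) →ₐ[k] OverlapRing k ν o)
  | .left_e₄ => leafTrans₀ k (ν 4) (ν 3) (ν 0) (b 3)
  | .left_e₅ => leafTrans₁ k (ν 4) (ν 3) (ν 0) (b 4)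
  | .left_mid₁ => endTrans₁ k (ν 4) (ν 3) (ν 0) (ν 1) (b 0)
  | .mid₁_mid₂ => midTrans k (ν 1) (ν 0) (ν 2) (b 1)
  | .right_mid₂ => endTrans₂ k (ν 6) (ν 5) (ν 2) (ν 1) (b 2)
  | .right_e₆ => leafTrans₀ k (ν 6) (ν 5) (ν 2) (b 5)
  | .right_e₇ => leafTrans₁ k (ν 6) (ν 5) (ν 2) (b 6)

lemma transition_open (b ν : Fin 7 → ℕ) (o : Overlap) :
    IsOpenImmersion (Spec.map (CommRingCat.ofHom (transition k b ν o).toRingHom)) := by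
  cases o
  · exact leafTrans₀_open _ _ _ _
  · exact leafTrans₁_open _ _ _ _
  · exact endTrans₁_open _ _ _ _ _
  · exact midTrans_open _ _ _ _
  · exact endTrans₂_open _ _ _ _ _
  · exact leafTrans₀_open _ _ _ _
  · exact leafTrans₁_open _ _ _ _

lemma transition_unit (b ν : Fin 7 → ℕ) (o : Overlap) :
    IsUnit (transition k b ν o (tgtFun k ν o)) := by
  cases o
  · exact leafTrans₀_unit _ _ _ _
  · exact leafTrans₁_unit _ _ _ _
  · exact endTrans₁_unit _ _ _ _ _
  · exact midTrans_unit _ _ _ _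
  · exact endTrans₂_unit _ _ _ _ _
  · exact leafTrans₀_unit _ _ _ _
  · exact leafTrans₁_unit _ _ _ _

/-- The shape of the gluing diagram: charts and overlaps. -/
abbrev shape : Limits.MultispanShape.{0, 0} where
  L := Overlap
  R := Chart
  fst := src
  snd := tgt

/-- The gluing diagram of affine schemes. -/
abbrev diagram (k : Type u) [Field k] (b ν : Fin 7 → ℕ) :
    Limits.MultispanIndex shape Scheme.{u} where
  left o := Spec (.of (OverlapRing k ν o))
  right c := Spec (.of (CoordRing k ν c))
  fst o := Spec.map (CommRingCat.ofHom (algebraMap (CoordRing k ν (src o)) (OverlapRing k ν o)))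
  snd o := Spec.map (CommRingCat.ofHom (transition k b ν o).toRingHom)

/-! ### The gluing diagram is a gluing of open subschemes without triple intersections -/

open Limits in
instance : Quiver.IsThin (WalkingMultispan shape) := by
  rintro (a | c) (a' | c')
  · infer_instance
  · refine ⟨fun f g => ?_⟩
    change WalkingMultispan.Hom _ _ at f g
    cases a <;> cases f <;> cases g <;> rfl
  · infer_instance
  · infer_instance

open Limits in
instance (b ν : Fin 7 → ℕ) {i j : WalkingMultispan shape} (f : i ⟶ j) :
    IsOpenImmersion ((diagram k b ν).multispan.map f) := by
  rcases f with _ | o | o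
  · change IsOpenImmersion (𝟙 _)
    infer_instance
  · change IsOpenImmersion
      (Spec.map (CommRingCat.ofHom (algebraMap (CoordRing k ν (src o)) (OverlapRing k ν o))))
    infer_instance
  · exact transition_open b ν o

open Limits in
/-- The function that is invertible on an overlap. -/
def arrowFun (k : Type u) [Field k] (ν : Fin 7 → ℕ) {o : Overlap} {c : Chart} :
    WalkingMultispan.Hom (J := shape) (.left o) (.right c) → CoordRing k ν c
  | .fst o => srcFun k ν o
  | .snd o => tgtFun k ν o

open Limits in
lemma arrowFun_notMem (b ν : Fin 7 → ℕ) {o : Overlap} {c : Chart}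
    (f : WalkingMultispan.Hom (J := shape) (.left o) (.right c))
    (z : PrimeSpectrum (OverlapRing k ν o)) :
    arrowFun k ν f ∉
      PrimeSpectrum.asIdeal (R := CoordRing k ν c) ((diagram k b ν).multispan.map f z) := by
  intro h
  have key : ∀ {R : Type u} [CommRing R] (φ : R →+* OverlapRing k ν o) (r : R), IsUnit (φ r) →
      r ∉ (PrimeSpectrum.comap φ z).asIdeal := fun φ r hr h' =>
    z.2.ne_top (Ideal.eq_top_of_isUnit_mem _ h' hr)
  rcases f with _ | o | o
  · exact key (algebraMap (CoordRing k ν (src o)) (OverlapRing k ν o)) _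
      (IsLocalization.Away.algebraMap_isUnit (srcFun k ν o)) h
  · exact key (transition k b ν o).toRingHom _ (transition_unit b ν o) h

lemma side_nilp (n m l : ℕ) : IsNilpotent
    ((ChartRing.x _ _ - 1) * ChartRing.x _ _ * ChartRing.y _ _ : SideRing k n m l) := by
  refine ⟨n + m + l, ?_⟩
  have h := rel_left (AlgHom.id k (SideRing k n m l))
  simp only [AlgHom.id_apply] at h
  rw [mul_pow, mul_pow]
  linear_combination ((ChartRing.x _ _ - 1) ^ (m + l) * ChartRing.x _ _ ^ (n + l) *
    ChartRing.y _ _ ^ (n + m)) * h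

lemma mid_nilp (p : MvPolynomial (Fin 2) k) (m l : ℕ) :
    IsNilpotent (ChartRing.x _ _ * ChartRing.y _ _ : MidRing k p m l) := by
  refine ⟨m + l, ?_⟩
  have h := rel_mid (AlgHom.id k (MidRing k p m l))
  simp only [AlgHom.id_apply] at h
  rw [mul_pow]
  linear_combination (ChartRing.x _ _ ^ l * ChartRing.y _ _ ^ m) * h

lemma isNilpotent_of_eq {R : Type u} [CommRing R] {a b c : R} (ha : IsNilpotent a)
    (h : b = a * c) : IsNilpotent b := h ▸ (Commute.all a c).isNilpotent_mul_right ha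

lemma side_nilp_12 (n m l : ℕ) :
    IsNilpotent ((ChartRing.y _ _ * (ChartRing.x _ _ - 1)) *
      (ChartRing.y _ _ * ChartRing.x _ _) : SideRing k n m l) :=
  isNilpotent_of_eq (side_nilp n m l) (c := ChartRing.y _ _) (by ring)

lemma side_nilp_13 (n m l : ℕ) :
    IsNilpotent ((ChartRing.y _ _ * (ChartRing.x _ _ - 1)) *
      (ChartRing.x _ _ * (ChartRing.x _ _ - 1)) : SideRing k n m l) :=
  isNilpotent_of_eq (side_nilp n m l) (c := (ChartRing.x _ _ - 1)) (by ring)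

lemma side_nilp_21 (n m l : ℕ) :
    IsNilpotent ((ChartRing.y _ _ * ChartRing.x _ _) *
      (ChartRing.y _ _ * (ChartRing.x _ _ - 1)) : SideRing k n m l) :=
  isNilpotent_of_eq (side_nilp n m l) (c := ChartRing.y _ _) (by ring)

lemma side_nilp_23 (n m l : ℕ) :
    IsNilpotent ((ChartRing.y _ _ * ChartRing.x _ _) *
      (ChartRing.x _ _ * (ChartRing.x _ _ - 1)) : SideRing k n m l) :=
  isNilpotent_of_eq (side_nilp n m l) (c := ChartRing.x _ _) (by ring)

lemma side_nilp_31 (n m l : ℕ) :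
    IsNilpotent ((ChartRing.x _ _ * (ChartRing.x _ _ - 1)) *
      (ChartRing.y _ _ * (ChartRing.x _ _ - 1)) : SideRing k n m l) :=
  isNilpotent_of_eq (side_nilp n m l) (c := (ChartRing.x _ _ - 1)) (by ring)

lemma side_nilp_32 (n m l : ℕ) :
    IsNilpotent ((ChartRing.x _ _ * (ChartRing.x _ _ - 1)) *
      (ChartRing.y _ _ * ChartRing.x _ _) : SideRing k n m l) :=
  isNilpotent_of_eq (side_nilp n m l) (c := ChartRing.x _ _) (by ring)

lemma mid_nilp' (p : MvPolynomial (Fin 2) k) (m l : ℕ) :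
    IsNilpotent (ChartRing.y _ _ * ChartRing.x _ _ : MidRing k p m l) :=
  isNilpotent_of_eq (mid_nilp p m l) (c := 1) (by ring)

open Limits in
lemma arrowFun_nilp (ν : Fin 7 → ℕ) {o o' : Overlap} {c : Chart}
    (f : WalkingMultispan.Hom (J := shape) (.left o) (.right c))
    (g : WalkingMultispan.Hom (J := shape) (.left o') (.right c)) (h : o ≠ o') :
    IsNilpotent (arrowFun k ν f * arrowFun k ν g) := by
  cases o <;> cases o' <;> first
    | exact absurd rfl h
    | (cases f <;> cases g)
  · exact side_nilp_12 _ _ _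
  · exact side_nilp_13 _ _ _
  · exact side_nilp_21 _ _ _
  · exact side_nilp_23 _ _ _
  · exact side_nilp_31 _ _ _
  · exact side_nilp_32 _ _ _
  · exact mid_nilp _ _ _
  · exact mid_nilp' _ _ _
  · exact mid_nilp _ _ _
  · exact mid_nilp' _ _ _
  · exact side_nilp_31 _ _ _
  · exact side_nilp_32 _ _ _
  · exact side_nilp_13 _ _ _
  · exact side_nilp_12 _ _ _
  · exact side_nilp_23 _ _ _
  · exact side_nilp_21 _ _ _

open Limits in
instance (b ν : Fin 7 → ℕ) :
    ((diagram k b ν).multispan ⋙ Scheme.forget).IsLocallyDirected := by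
  constructor
  intro i j c fi fj xi xj h
  by_cases hi : i = c
  · subst hi
    obtain rfl := Subsingleton.elim (𝟙 i) fi
    refine ⟨j, fj, 𝟙 j, xj, ?_, by simp⟩
    rw [← h]; simp
  by_cases hj : j = c
  · subst hj
    obtain rfl := Subsingleton.elim (𝟙 j) fj
    refine ⟨i, 𝟙 i, fi, xi, by simp, ?_⟩
    rw [h]; simp
  rcases i with o | i
  swap
  · change WalkingMultispan.Hom _ _ at fi
    cases fi; exact absurd rfl hi
  rcases j with o' | j
  swap
  · change WalkingMultispan.Hom _ _ at fj
    cases fj; exact absurd rfl hj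
  rcases c with c | c
  · change WalkingMultispan.Hom _ _ at fi
    cases fi; exact absurd rfl hi
  by_cases ho : o = o'
  · subst ho
    obtain rfl := Subsingleton.elim fi fj
    refine ⟨_, 𝟙 _, 𝟙 _, xi, ?_⟩
    have : Function.Injective ((diagram k b ν).multispan.map fi) :=
      ((diagram k b ν).multispan.map fi).isOpenEmbedding.injective
    have h' : xi = xj := this h
    rw [h']
    simp only [CategoryTheory.Functor.map_id]
    exact ⟨rfl, rfl⟩
  · exfalso
    have h1 := arrowFun_notMem b ν fi xi
    have h2 := arrowFun_notMem b ν fj xj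
    replace h : (diagram k b ν).multispan.map fi xi = (diagram k b ν).multispan.map fj xj := h
    rw [← h] at h2
    obtain ⟨N, hN⟩ := arrowFun_nilp (k := k) ν fi fj ho
    let z : PrimeSpectrum (CoordRing k ν c) := (diagram k b ν).multispan.map fi xi
    have hz : (arrowFun k ν fi * arrowFun k ν fj) ^ N ∈ z.asIdeal := by
      rw [hN]; exact z.asIdeal.zero_mem
    rcases z.2.mem_or_mem (z.2.mem_of_pow_mem N hz) with h' | h'
    · exact h1 h'
    · exact h2 h'

/-- The plumbing scheme: the affine charts `Spec k[x, y, p⁻¹] / (f)` glued along the overlaps by the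
coordinate changes. -/
def scheme (k : Type u) [Field k] (b ν : Fin 7 → ℕ) : Scheme.{u} :=
  Limits.multicoequalizer (diagram k b ν)

/-- The inclusion of a chart. -/
def chartMap (k : Type u) [Field k] (b ν : Fin 7 → ℕ) (c : Chart) :
    Spec (.of (CoordRing k ν c)) ⟶ scheme k b ν :=
  Limits.Multicoequalizer.π (diagram k b ν) c

instance (b ν : Fin 7 → ℕ) (c : Chart) : IsOpenImmersion (chartMap k b ν c) :=
  inferInstanceAs (IsOpenImmersion (Limits.colimit.ι (diagram k b ν).multispan (.right c)))

/-- The structure morphism of the plumbing scheme. -/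
def structureMap (k : Type u) [Field k] (b ν : Fin 7 → ℕ) : scheme k b ν ⟶ Spec (.of k) :=
  Limits.Multicoequalizer.desc (diagram k b ν) _
    (fun c => Spec.map (CommRingCat.ofHom (algebraMap k (CoordRing k ν c)))) (by
      intro o
      rw [← Spec.map_comp, ← Spec.map_comp]
      congr 1
      ext a
      exact ((IsScalarTower.algebraMap_apply k (CoordRing k ν (src o)) (OverlapRing k ν o) a).symm.trans
        ((transition k b ν o).commutes a).symm))

/-- The image of a chart. -/
def chartOpen (k : Type u) [Field k] (b ν : Fin 7 → ℕ) (c : Chart) : (scheme k b ν).Opens :=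
  chartMap k b ν c ''ᵁ ⊤

/-- An element of the coordinate ring of a chart as a function on the image of the chart. -/
def chartFun (k : Type u) [Field k] (b ν : Fin 7 → ℕ) (c : Chart) (r : CoordRing k ν c) :
    Γ(scheme k b ν, chartOpen k b ν c) :=
  ((chartMap k b ν c).appIso ⊤).inv ((Scheme.ΓSpecIso (.of (CoordRing k ν c))).inv r)

/-- The open cover `U₀ = (E₁ ∖ E₂) ∪ E₄ ∪ E₅`,
`U₁ = (E₁ ∖ (E₄ ∪ E₅)) ∪ E₂ ∪ (E₃ ∖ (E₆ ∪ E₇))`, `U₂ = (E₃ ∖ E₂) ∪ E₆ ∪ E₇`. -/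
def cover (k : Type u) [Field k] (b ν : Fin 7 → ℕ) : Fin 3 → (scheme k b ν).Opens :=
  ![chartOpen k b ν .left ⊔ chartOpen k b ν .e₄ ⊔ chartOpen k b ν .e₅,
    chartOpen k b ν .mid₁ ⊔ chartOpen k b ν .mid₂,
    chartOpen k b ν .right ⊔ chartOpen k b ν .e₆ ⊔ chartOpen k b ν .e₇]

/-- `θ` is the vector field `x₃ ∂/∂x₃` on `U₁ ∩ U₂`, where `(x₃, y₃)` are the coordinates of the
chart `right`, which contains `U₁ ∩ U₂`. -/
def IsEulerField (k : Type u) [Field k] (b ν : Fin 7 → ℕ)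
    (θ : Tangent.tangentSections (structureMap k b ν) (cover k b ν 1 ⊓ cover k b ν 2)) : Prop :=
  let V := (cover k b ν 1 ⊓ cover k b ν 2) ⊓ chartOpen k b ν .right
  let x₃ : Γ(scheme k b ν, V) := Tangent.resFun inf_le_right (chartFun k b ν .right (cx k ν .right))
  let y₃ : Γ(scheme k b ν, V) := Tangent.resFun inf_le_right (chartFun k b ν .right (cy k ν .right))
  Tangent.act θ inf_le_left x₃ = x₃ ∧ Tangent.act θ inf_le_left y₃ = 0

end Charts

end

/-! ### Weighted dual graphs and multiplicities -/

/-- A weighted dual graph all of whose vertices are curves of arithmetic genus `0`. -/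
structure WeightedGraph (V : Type) where
  /-- the underlying graph -/
  graph : SimpleGraph V
  /-- the self-intersection numbers -/
  selfInt : V → ℤ

open Classical in
/-- The intersection number `E_i · E_j`. -/
noncomputable def WeightedGraph.inter {V : Type} (Γ : WeightedGraph V) (i j : V) : ℤ :=
  if i = j then Γ.selfInt i else if Γ.graph.Adj i j then 1 else 0

/-- The intersection number `Z · E_i` of the cycle `Z = ∑ j, z j E_j` with `E_i`. -/
noncomputable def WeightedGraph.interCycle {V : Type} [Fintype V] (Γ : WeightedGraph V)
    (z : V → ℕ) (i : V) : ℤ :=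
  ∑ j, (z j : ℤ) * Γ.inter j i

/-- The graph `D̃_{n+3}`: a chain of `n` vertices with two further vertices attached to each of its
two end vertices. -/
def dTilde (n : ℕ) : SimpleGraph (Fin n ⊕ Fin 4) :=
  SimpleGraph.fromRel fun v w => match v, w with
    | .inl i, .inl j => i.val + 1 = j.val
    | .inl i, .inr l => (i.val = 0 ∧ l.val < 2) ∨ (i.val + 1 = n ∧ 2 ≤ l.val)
    | _, _ => False

/-- `Γ` is a `_*D̃_{n+3}` graph: a `D̃_{n+3}` with self-intersection `-2` at the four vertices outside
the chain and at most `-2` on the chain. -/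
def IsStarDTilde {V : Type} (n : ℕ) (Γ : WeightedGraph V) : Prop :=
  2 ≤ n ∧ ∃ e : Γ.graph ≃g dTilde n,
    (∀ l, Γ.selfInt (e.symm (.inr l)) = -2) ∧ ∀ i, Γ.selfInt (e.symm (.inl i)) ≤ -2

/-- `N` is the significant multiplicity for the cycle `z̃ = ∑ v, (s.count v) E_v` and the sequence
`0 = z̃_0 < z̃_1 < ⋯ < z̃_m = z̃` given by adding the elements of the list `s` one after the other. -/
def IsSignificantMultiplicity {V : Type} [Fintype V] [DecidableEq V] (p : ℕ) (Γ : WeightedGraph V)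
    (s : List V) (N : ℕ) : Prop :=
  ∃ τ l : ℤ,
    IsGreatest {t | ∃ m : Fin s.length,
      t = Γ.interCycle (fun v => (s.take m).count v) (s.get m)} τ ∧
    IsGreatest ({0, 2 * (2 * 0 - 2)} ∪ {t | ∃ v, t = 2 * 0 - 2 - Γ.selfInt v}) l ∧
    1 ≤ τ ∧ IsLeast {M : ℕ | τ + l + 1 ≤ (M : ℤ) ∧ M.Coprime p} N

/-- `ν` is a choice of multiplicities for the plumbing scheme in characteristic `p`: the product of
the significant multiplicity with the multiplicities `z` of an anti-ample cycle that are prime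
to `p`. -/
def IsPlumbingMultiplicity {V : Type} [Fintype V] [DecidableEq V] (p : ℕ) (Γ : WeightedGraph V)
    (ν : V → ℕ) : Prop :=
  ∃ (z : V → ℕ) (s : List V) (N : ℕ), (∀ v, (z v).Coprime p) ∧ (∀ v, Γ.interCycle z v < 0) ∧
    (∀ v, s.count v = z v) ∧ IsSignificantMultiplicity p Γ s N ∧ ∀ v, ν v = N * z v

/-- The numbers `- E_i²` for the components `E₁, …, E₇` of the example. -/
def exB : Fin 7 → ℕ := ![2, 3, 2, 2, 2, 2, 2]

/-- The multiplicities of the components `E₁, …, E₇` in the example. -/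
def exMult : Fin 7 → ℕ := ![28, 20, 28, 16, 16, 16, 16]

/-- The weighted dual graph of the example; `i : Fin 7` stands for `E_{i+1}`. -/
def exGraph : WeightedGraph (Fin 7) where
  graph := SimpleGraph.fromEdgeSet {s(0, 1), s(1, 2), s(0, 3), s(0, 4), s(2, 5), s(2, 6)}
  selfInt i := -(exB i : ℤ)

end Plumbing

/-! Suppose that the cocycle is a coboundary. Then there are vector fields θ₀, θ₁, θ₂ on U₀, U₁, U₂
such that θ₀ = θ₁ on U₀ ∩ U₁ and θ₂ - θ₁ is the Euler field on U₁ ∩ U₂. A derivation is logarithmic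
along every component whose multiplicity is prime to the characteristic
(`ChartRing.dvd_derivation`). So θ₁ multiplies a local equation of E₂ by a function w, and the proof
compares the values of w at E₁ ∩ E₂ and E₂ ∩ E₃.

At E₁ ∩ E₂ the equation of E₂ restricts to the coordinate 1/x₀ of E₁. The x₀-component of θ₀ on E₁
vanishes at the points of E₄ and E₅, and since θ₀ = θ₁ it also vanishes at infinity. These are three
zeros on a projective line whose tangent bundle has degree 2, so the component is zero and w = 0 at
that point. On E₃ the same count kills the x₃-component of θ₂, so that of θ₁ is -x₃; as the equation
of E₂ restricts to 1/x₃, w = 1 at E₂ ∩ E₃. Both cases are `residue_of_edge`, with `eq_C_of_edge` as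
its computation.

Along E₂ the two local equations are related by y₂ = x₁y₁³. In characteristic 3 the factor y₁³ has
derivative zero, so the two functions w agree on E₂ and form a regular function on a projective
line, which is constant (`residue_eq`). Hence 0 = 1.

For sheaf cohomology no comparison with Čech cohomology is needed: (U₀ ∪ U₁) ∩ U₂ = U₁ ∩ U₂, and the
Mayer–Vietoris sequence of U₀ ∪ U₁ and U₂ reduces nonvanishing to the same contradiction
(`MayerVietoris.nontrivial_H1`). Vector fields pass to derivations of rings by `immDer_map`.
Conversely `exists_tangentSection` produces the Euler field from a derivation. -/

namespace Plumbing

/-! ### The dual graph and its multiplicities -/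

/-- The matrix of intersection numbers of the example. -/
def exMatrix : Fin 7 → Fin 7 → ℤ :=
  ![![-2, 1, 0, 1, 1, 0, 0],
    ![1, -3, 1, 0, 0, 0, 0],
    ![0, 1, -2, 0, 0, 1, 1],
    ![1, 0, 0, -2, 0, 0, 0],
    ![1, 0, 0, 0, -2, 0, 0],
    ![0, 0, 1, 0, 0, -2, 0],
    ![0, 0, 1, 0, 0, 0, -2]]

lemma exGraph_inter (i j : Fin 7) : exGraph.inter i j = exMatrix i j := by
  unfold WeightedGraph.inter exGraph
  simp only [SimpleGraph.fromEdgeSet_adj]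
  revert i j
  simp only [Set.mem_insert_iff, Set.mem_singleton_iff]
  -- `WeightedGraph.inter` branches on classical instances; the same formula with computable
  -- instances can be evaluated on all pairs.
  have h : ∀ i j : Fin 7, (if i = j then -(exB i : ℤ) else if
      (s(i, j) = s(0, 1) ∨ s(i, j) = s(1, 2) ∨
      s(i, j) = s(0, 3) ∨ s(i, j) = s(0, 4) ∨ s(i, j) = s(2, 5) ∨ s(i, j) = s(2, 6)) ∧ i ≠ j
      then 1 else 0) = exMatrix i j := by decide
  intro i j
  rw [← h i j]

lemma exGraph_interCycle (z : Fin 7 → ℕ) (i : Fin 7) :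
    exGraph.interCycle z i = ∑ j, (z j : ℤ) * exMatrix j i := by
  simp only [WeightedGraph.interCycle, exGraph_inter]

/-- The identification of the vertices of the example with those of `D̃₆`. -/
def exVertexEquiv : Fin 7 ≃ Fin 3 ⊕ Fin 4 where
  toFun := ![.inl 0, .inl 1, .inl 2, .inr 0, .inr 1, .inr 2, .inr 3]
  invFun := Sum.elim ![0, 1, 2] ![3, 4, 5, 6]
  left_inv := by decide
  right_inv := by decide

lemma isStarDTilde_exGraph : IsStarDTilde 3 exGraph := by
  refine ⟨by norm_num, ⟨exVertexEquiv, ?_⟩, ?_, ?_⟩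
  · intro i j
    simp only [exGraph, dTilde, SimpleGraph.fromEdgeSet_adj, SimpleGraph.fromRel_adj,
      Set.mem_insert_iff, Set.mem_singleton_iff]
    fin_cases i <;> fin_cases j <;> simp [exVertexEquiv]
  · intro l
    change -(exB (exVertexEquiv.symm (.inr l)) : ℤ) = -2
    revert l
    decide
  · intro i
    change -(exB (exVertexEquiv.symm (.inl i)) : ℤ) ≤ -2
    revert i
    decide

/-- The order in which the components are added to reach the anti-ample cycle of the example. -/
def exSequence : List (Fin 7) :=
  [0, 1, 2, 3, 4, 0, 5, 6, 2, 1, 0, 3, 4, 0, 1, 2, 5, 6, 2, 3, 0, 4, 1, 0, 2, 5, 6, 2, 1, 3, 0, 4,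
    5, 2, 6]

/-- Here τ = 1 and λ = -2 + 3 = 1, the latter attained at E₂. The bound τ + λ + 1 = 3 is not prime
to 3, so the least admissible integer is 4. The value τ is reached when E₂ is added to E₁, the step
with index 1. -/
lemma isSignificantMultiplicity_exSequence :
    IsSignificantMultiplicity 3 exGraph exSequence 4 := by
  refine ⟨1, 1, ⟨⟨⟨1, by decide⟩, ?_⟩, ?_⟩, ⟨Or.inr ⟨1, by simp [exGraph, exB]⟩, ?_⟩, le_rfl,
    ⟨by norm_num, by decide⟩, ?_⟩
  · rw [exGraph_interCycle]
    decide
  · rintro _ ⟨m, rfl⟩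
    rw [exGraph_interCycle]
    revert m
    decide
  · rintro _ ((rfl | rfl) | ⟨v, rfl⟩)
    · norm_num
    · norm_num
    · change (2 * 0 - 2 - -(exB v : ℤ)) ≤ 1
      revert v
      decide
  · rintro M ⟨h, hM⟩
    by_contra! hlt
    obtain rfl : M = 3 := by omega
    exact absurd hM (by decide)

lemma isPlumbingMultiplicity_exMult : IsPlumbingMultiplicity 3 exGraph exMult := by
  -- This cycle has intersection number -1 with every component, and 4 times it is `exMult`.
  refine ⟨![7, 5, 7, 4, 4, 4, 4], exSequence, 4, by decide, ?_, by decide,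
    isSignificantMultiplicity_exSequence, by decide⟩
  intro v
  rw [exGraph_interCycle]
  revert v
  decide

end Plumbing

/-! ### Derivations of a ring and dual numbers -/

namespace Tangent

section SelfDerivation

variable {A : Type u} [CommRing A]

/-- The derivations of a ring into itself. -/
abbrev SelfDerivation (A : Type u) [CommRing A] : Type u := Derivation ℤ A A

namespace SelfDerivation

variable (D : SelfDerivation A)

lemma map_mul (a b : A) : D (a * b) = a * D b + b * D a := D.leibniz a b

lemma map_one : D 1 = 0 := D.map_one_eq_zero

lemma map_pow (a : A) (n : ℕ) : D (a ^ n) = n * a ^ (n - 1) * D a := by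
  rw [Derivation.leibniz_pow, nsmul_eq_mul, smul_eq_mul, mul_assoc]

end SelfDerivation

/-- The derivation given by an additive map that satisfies the Leibniz rule. -/
noncomputable def selfDerivation (D : A → A) (hadd : ∀ a b, D (a + b) = D a + D b)
    (hmul : ∀ a b, D (a * b) = a * D b + b * D a) : SelfDerivation A :=
  Derivation.mk' (AddMonoidHom.toIntLinearMap (AddMonoidHom.mk' D hadd)) hmul

/-- The derivation given by a deformation of the identity over the dual numbers. -/
noncomputable def derivationOfDual (Ψ : A →+* DualNumber A) (h : ∀ a, (Ψ a).fst = a) :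
    SelfDerivation A :=
  selfDerivation (fun a => (Ψ a).snd) (fun a b => by simp) (fun a b => by
    rw [map_mul, TrivSqZeroExt.snd_mul, h, h]
    exact congrArg (a * (Ψ b).snd + ·) (mul_comm _ _))

/-- For the Euler field, which kills y: the deformation y + 0·ε satisfies the same relation as y. -/
lemma inl_add_inr_zero_pow {z : A} {l : ℕ} (h : z ^ l = 0) :
    (TrivSqZeroExt.inl z + TrivSqZeroExt.inr 0 : DualNumber A) ^ l = 0 := by
  rw [TrivSqZeroExt.inr_zero, add_zero]
  refine (map_pow (TrivSqZeroExt.inlHom A A) z l).symm.trans ?_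
  rw [h, map_zero]

lemma derivationOfDual_apply (Ψ : A →+* DualNumber A) (h : ∀ a, (Ψ a).fst = a) (a : A) :
    derivationOfDual Ψ h a = (Ψ a).snd := rfl

end SelfDerivation

end Tangent

/-! ### Logarithmic derivations of the chart rings -/

namespace Plumbing

open Tangent

namespace ChartRing

variable {k : Type u} [Field k] {f p : MvPolynomial (Fin 2) k}

lemma exists_mul_eq_mk (a : ChartRing f p) :
    ∃ (n : ℕ) (A : MvPolynomial (Fin 2) k), mk f p p ^ n * a = mk f p A := by
  obtain ⟨n, c, hc⟩ := IsLocalization.Away.surj (Ideal.Quotient.mk (Ideal.span {f}) p) a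
  obtain ⟨A, rfl⟩ := Ideal.Quotient.mk_surjective c
  exact ⟨n, A, by rw [mul_comm]; exact hc⟩

lemma mk_eq_zero {A : MvPolynomial (Fin 2) k} (h : mk f p A = 0) : ∃ n : ℕ, f ∣ p ^ n * A := by
  obtain ⟨⟨_, n, rfl⟩, hn⟩ := (IsLocalization.map_eq_zero_iff
    (Submonoid.powers (Ideal.Quotient.mk (Ideal.span {f}) p)) (ChartRing f p)
    (Ideal.Quotient.mk (Ideal.span {f}) A)).1 h
  refine ⟨n, ?_⟩
  rw [← Ideal.mem_span_singleton, ← Ideal.Quotient.eq_zero_iff_mem, map_mul, map_pow]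
  exact hn

lemma isUnit_mk_p : IsUnit (mk f p p) := by
  have h := isUnit_p (f := f) (p := p)
  rwa [← mk_eq_aeval] at h

lemma mk_f : mk f p f = 0 := by
  have h := aeval_f (f := f) (p := p)
  rwa [← mk_eq_aeval] at h

/-- A derivation is logarithmic along the components of multiplicity prime to the characteristic. -/
lemma dvd_derivation {q g : MvPolynomial (Fin 2) k} {m : ℕ} (hf : f = q ^ m * g) (hq : Prime q)
    (hg : ¬ q ∣ g) (hp : ¬ q ∣ p) (hm : (m : k) ≠ 0)
    (D : SelfDerivation (ChartRing f p)) : mk f p q ∣ D (mk f p q) := by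
  obtain _ | m := m
  · simp at hm
  -- Up to powers of the unit p, the polynomials A and B represent D q and D g.
  obtain ⟨n₁, A, hA⟩ := exists_mul_eq_mk (D (mk f p q))
  obtain ⟨n₂, B, hB⟩ := exists_mul_eq_mk (D (mk f p g))
  -- This is D f = 0 for f = q ^ (m + 1) * g, expanded by the Leibniz rule.
  have h0 : mk f p q ^ (m + 1) * D (mk f p g) +
      mk f p g * (((m : ChartRing f p) + 1) * mk f p q ^ m * D (mk f p q)) = 0 := by
    have h := congrArg D (mk_f (f := f) (p := p))
    rw [map_zero] at h
    rw [show mk f p f = mk f p q ^ (m + 1) * mk f p g by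
      rw [← map_pow, ← map_mul, ← hf], D.leibniz, D.leibniz_pow] at h
    simpa [smul_eq_mul, nsmul_eq_mul, mul_assoc] using h
  have h1 : mk f p (q ^ m * (p ^ n₁ * q * B + (m + 1) * p ^ n₂ * g * A)) = 0 := by
    simp only [map_mul, map_add, map_pow, map_natCast, map_one, ← hA, ← hB]
    linear_combination (mk f p p ^ n₁ * mk f p p ^ n₂) * h0
  obtain ⟨n, hn⟩ := mk_eq_zero h1
  -- Back in the polynomial ring, q ^ (m + 1) divides the lifted relation. After cancelling q ^ m,
  -- only the term (m + 1) p ^ n₂ g A survives modulo q, and of its factors only A can be divisible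
  -- by q.
  have h2 : q ^ m * q ∣ q ^ m * (p ^ n * (p ^ n₁ * q * B + (m + 1) * p ^ n₂ * g * A)) := by
    refine Dvd.dvd.trans ?_ (Dvd.dvd.trans hn (dvd_of_eq (by ring)))
    rw [hf, pow_succ]
    exact dvd_mul_right _ _
  replace h2 := (mul_dvd_mul_iff_left (pow_ne_zero m hq.ne_zero)).1 h2
  replace h2 := (hq.dvd_or_dvd h2).resolve_left (fun h => hp (hq.dvd_of_dvd_pow h))
  rw [dvd_add_right (Dvd.intro_left (p ^ n₁ * B) (by ring))] at h2
  have h3 : q ∣ A := by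
    refine (hq.dvd_or_dvd h2).resolve_left fun h => ?_
    refine (hq.dvd_or_dvd h).elim (fun h => ?_) hg
    refine (hq.dvd_or_dvd h).elim (fun h => ?_) (fun h => hp (hq.dvd_of_dvd_pow h))
    refine hq.not_isUnit (isUnit_of_dvd_unit h ?_)
    have : (m : MvPolynomial (Fin 2) k) + 1 = MvPolynomial.C (((m + 1 : ℕ) : k)) := by simp
    rw [this]
    exact (IsUnit.mk0 _ hm).map MvPolynomial.C
  rw [← (isUnit_mk_p.pow n₁).dvd_mul_left, hA]
  exact map_dvd _ h3

end ChartRing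

section Primes

open MvPolynomial

variable {k : Type u} [Field k]

/-- A translation of the plane carries X 0 to X 0 - 1. -/
lemma prime_X_sub_one : Prime (X 0 - 1 : MvPolynomial (Fin 2) k) := by
  let e : MvPolynomial (Fin 2) k ≃ₐ[k] MvPolynomial (Fin 2) k :=
    AlgEquiv.ofAlgHom (aeval ![X 0 - 1, X 1]) (aeval ![X 0 + 1, X 1])
      (by ext i; fin_cases i <;> simp) (by ext i; fin_cases i <;> simp)
  have h : e (X 0) = X 0 - 1 := by simp [e]
  rw [← h]
  exact (MulEquiv.prime_iff e).2 (X_prime)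

/-- The point (a, b) lies on the curve q = 0 but not on g = 0. -/
lemma not_dvd_of_aeval {q g : MvPolynomial (Fin 2) k} (a b : k) (hq : aeval ![a, b] q = 0)
    (hg : aeval ![a, b] g ≠ 0) : ¬ q ∣ g := by
  rintro ⟨c, rfl⟩
  exact hg (by rw [map_mul, hq, zero_mul])

/-- In a side chart x = 0 is the equation of E₄ or E₆, and x = 1 in the next lemma that of E₅ or E₇.
-/
lemma side_dvd_x {n m l : ℕ} (hm : (m : k) ≠ 0)
    (D : SelfDerivation (SideRing k n m l)) :
    ChartRing.x _ _ ∣ D (ChartRing.x _ _) :=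
  ChartRing.dvd_derivation (g := (X 0 - 1) ^ n * X 1 ^ l) (by ring) X_prime
    (not_dvd_of_aeval 0 1 (by simp) (by simp)) (not_dvd_of_aeval 0 1 (by simp) (by simp)) hm D

lemma side_dvd_x_sub_one {n m l : ℕ} (hn : (n : k) ≠ 0)
    (D : SelfDerivation (SideRing k n m l)) :
    ChartRing.x _ _ - 1 ∣ D (ChartRing.x _ _) := by
  have h := ChartRing.dvd_derivation (p := 1) (g := X 0 ^ m * X 1 ^ l) (mul_assoc _ _ _)
    prime_X_sub_one (not_dvd_of_aeval 1 1 (by simp) (by simp))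
    (not_dvd_of_aeval 1 1 (by simp) (by simp)) hn D
  rw [map_sub, map_one, map_sub, D.map_one_eq_zero, sub_zero] at h
  exact h

/-- The equation of E₂ is x = 0 in `mid₁` and y = 0 in `mid₂`. -/
lemma mid₁_dvd_x {m l : ℕ} (hm : (m : k) ≠ 0)
    (D : SelfDerivation (MidRing k (1 - X 0) m l)) :
    ChartRing.x _ _ ∣ D (ChartRing.x _ _) :=
  ChartRing.dvd_derivation (g := X 1 ^ l) rfl X_prime
    (not_dvd_of_aeval 0 1 (by simp) (by simp)) (not_dvd_of_aeval 0 1 (by simp) (by simp)) hm D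

lemma mid₂_dvd_y {m l : ℕ} (hl : (l : k) ≠ 0)
    (D : SelfDerivation (MidRing k (1 - X 1) m l)) :
    ChartRing.y _ _ ∣ D (ChartRing.y _ _) :=
  ChartRing.dvd_derivation (g := X 0 ^ m) (mul_comm _ _) X_prime
    (not_dvd_of_aeval 1 0 (by simp) (by simp)) (not_dvd_of_aeval 1 0 (by simp) (by simp)) hl D

end Primes

/-! ### Regular functions on the projective line, via Laurent series at infinity -/

section Laurent

variable (k : Type u) [Field k]

/-- The inclusion of power series into Laurent series. -/
noncomputable def laurentOfPowerSeries : PowerSeries k →ₐ[k] LaurentSeries k where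
  toRingHom := HahnSeries.ofPowerSeries ℤ k
  commutes' _ := rfl

/-- The constant coefficient of power series. -/
noncomputable def constCoeff : PowerSeries k →ₐ[k] k where
  toRingHom := PowerSeries.constantCoeff
  commutes' a := by simp

/-- The inverse of the variable as a Laurent series. -/
noncomputable def invVar : LaurentSeries k := HahnSeries.single (-1 : ℤ) (1 : k)

variable {k}

lemma laurentOfPowerSeries_injective : Function.Injective (laurentOfPowerSeries k) :=
  HahnSeries.ofPowerSeries_injective

lemma constCoeff_apply (F : PowerSeries k) : constCoeff k F = PowerSeries.constantCoeff F := rfl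

lemma var_mul_invVar : laurentOfPowerSeries k PowerSeries.X * invVar k = 1 := by
  change HahnSeries.ofPowerSeries ℤ k PowerSeries.X * HahnSeries.single (-1 : ℤ) (1 : k) = 1
  rw [HahnSeries.ofPowerSeries_X, HahnSeries.single_mul_single]
  simp

lemma coeff_aeval_invVar (α : Polynomial k) (i : ℕ) :
    (Polynomial.aeval (invVar k) α).coeff (-(i : ℤ)) = α.coeff i := by
  induction α using Polynomial.induction_on' with
  | add a b ha hb => simp [ha, hb]
  | monomial n a =>
    rw [Polynomial.aeval_monomial, invVar, HahnSeries.single_pow, one_pow,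
      LaurentSeries.algebraMap_apply, HahnSeries.C_apply, HahnSeries.single_mul_single, zero_add,
      mul_one, Polynomial.coeff_monomial, HahnSeries.coeff_single]
    congr 1
    simp [eq_comm]

/-- A rational function that is regular on `𝔸¹` and at infinity is constant. -/
lemma eq_const_of_aeval_eq {α : Polynomial k} {F : PowerSeries k}
    (h : Polynomial.aeval (invVar k) α = laurentOfPowerSeries k F) :
    α = Polynomial.C (constCoeff k F) ∧ F = PowerSeries.C (constCoeff k F) := by
  have h1 : α = Polynomial.C (constCoeff k F) := by
    ext i
    -- The coefficient of degree i of α sits at exponent -i, where a power series has no coefficient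
    -- unless i = 0.
    rw [← coeff_aeval_invVar, h, Polynomial.coeff_C]
    change (HahnSeries.ofPowerSeries ℤ k F).coeff _ = _
    rw [PowerSeries.coeff_coe]
    obtain rfl | hi := eq_or_ne i 0
    · simp [constCoeff_apply]
    · rw [if_neg hi, if_pos (by omega)]
  refine ⟨h1, laurentOfPowerSeries_injective ?_⟩
  rw [← h, h1, Polynomial.aeval_C]
  rfl

lemma isUnit_one_sub_X : IsUnit (1 - PowerSeries.X : PowerSeries k) := by
  rw [PowerSeries.isUnit_iff_constantCoeff]
  simp

/-- With z the variable and s = 1/z, the hypothesis reads (s - 1) α(s) = c - W, and s - 1 = s(1 - z)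
gives α(s) = z (1 - z)⁻¹ (c - W). So α(s) is regular at infinity and vanishes there; being a
polynomial in s it is zero, whence W = c. This is the vanishing of a vector field with three zeros
on the projective line. -/
lemma eq_C_of_edge {α : Polynomial k} {W : PowerSeries k} {c : k}
    (h : laurentOfPowerSeries k PowerSeries.X * (invVar k * (invVar k - 1) *
      Polynomial.aeval (invVar k) α - algebraMap k _ c * invVar k) +
        laurentOfPowerSeries k W = 0) : W = PowerSeries.C c := by
  obtain ⟨v, hv⟩ := (isUnit_one_sub_X (k := k)).exists_right_inv
  have hv' := congrArg (laurentOfPowerSeries k) hv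
  have hz := var_mul_invVar (k := k)
  rw [map_mul, map_sub, map_one] at hv'
  have hC : laurentOfPowerSeries k (PowerSeries.C c) = algebraMap k _ c := rfl
  have h1 : Polynomial.aeval (invVar k) α =
      laurentOfPowerSeries k (v * PowerSeries.X * (PowerSeries.C c - W)) := by
    rw [map_mul, map_mul, map_sub, hC]
    set Z := laurentOfPowerSeries k PowerSeries.X
    set s := invVar k
    set V := laurentOfPowerSeries k v
    set a := Polynomial.aeval s α
    linear_combination (-a) * hv' + V * Z * h +
      (-V * Z * (s - 1) * a - V * a + V * Z * algebraMap k _ c) * hz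
  have h2 := (eq_const_of_aeval_eq h1).1
  rw [map_mul (constCoeff k), map_mul (constCoeff k),
    show constCoeff k PowerSeries.X = 0 by simp [constCoeff_apply], mul_zero, zero_mul,
    Polynomial.C_0] at h2
  rw [h2, map_zero] at h1
  have h3 := laurentOfPowerSeries_injective (h1.symm.trans (map_zero _).symm)
  -- Multiplying by 1 - z removes its inverse v.
  have h4 : PowerSeries.X * (PowerSeries.C c - W) = 0 := by
    linear_combination (1 - PowerSeries.X) * h3 - PowerSeries.X * (PowerSeries.C c - W) * hv
  have h5 := (mul_eq_zero.1 h4).resolve_left PowerSeries.X_ne_zero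
  exact (sub_eq_zero.1 h5).symm

end Laurent

end Plumbing

/-! ### Logarithmic residues along E₁, E₂ and E₃ -/

namespace Plumbing

open Tangent

section Compatible

open MvPolynomial

variable {k : Type u} [Field k]

/-- The restriction of functions to the first component of the chart. -/
noncomputable def sideEval (k : Type u) [Field k] {n m l : ℕ} (hl : l ≠ 0) :
    SideRing k n m l →ₐ[k] Polynomial k :=
  ChartRing.lift Polynomial.X 0 (by simp [hl]) (by simp)

/-- The image of the coordinate field of `𝔸¹ ∖ {0, 1}` in Laurent series at infinity. -/
noncomputable def sideLaurent (k : Type u) [Field k] {n m l : ℕ} (hl : l ≠ 0) :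
    SideRing k n m l →ₐ[k] LaurentSeries k :=
  (Polynomial.aeval (invVar k)).comp (sideEval k hl)

lemma sideLaurent_x {n m l : ℕ} (hl : l ≠ 0) :
    sideLaurent k hl (ChartRing.x _ _ : SideRing k n m l) = invVar k := by
  simp [sideLaurent, sideEval]

lemma sideLaurent_y {n m l : ℕ} (hl : l ≠ 0) :
    sideLaurent k hl (ChartRing.y _ _ : SideRing k n m l) = 0 := by
  simp [sideLaurent, sideEval]

lemma isUnit_invVar : IsUnit (invVar k) := IsUnit.of_mul_eq_one_right _ var_mul_invVar

lemma isUnit_invVar_sub_one : IsUnit (invVar k - 1) := by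
  have h : invVar k - 1 = invVar k * laurentOfPowerSeries k (1 - PowerSeries.X) := by
    rw [map_sub, map_one]
    linear_combination var_mul_invVar (k := k)
  rw [h]
  exact isUnit_invVar.mul (isUnit_one_sub_X.map _)

/-- The ring of the overlap of a side chart with a middle chart. -/
abbrev EndRing (k : Type u) [Field k] (n m l : ℕ) : Type u :=
  Localization.Away (ChartRing.x _ _ * (ChartRing.x _ _ - 1) : SideRing k n m l)

/-- The extension of `sideLaurent` to the locus where `x (x - 1)` is invertible. -/
noncomputable def overlapLaurent (k : Type u) [Field k] {n m l : ℕ} (hl : l ≠ 0) :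
    EndRing k n m l →ₐ[k] LaurentSeries k :=
  awayExt _ (sideLaurent k hl) (by
    rw [map_mul, map_sub, map_one, sideLaurent_x]
    exact isUnit_invVar.mul isUnit_invVar_sub_one)

lemma overlapLaurent_algebraMap {n m l : ℕ} (hl : l ≠ 0) (r : SideRing k n m l) :
    overlapLaurent k hl (algebraMap _ (EndRing k n m l) r) = sideLaurent k hl r :=
  awayExt_algebraMap _ _ _ _

lemma overlapLaurent_invLeft {n m l : ℕ} (hl : l ≠ 0) :
    overlapLaurent k hl (invLeft (ChartRing.x _ _) (ChartRing.x _ _ - 1 : SideRing k n m l)) =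
      laurentOfPowerSeries k PowerSeries.X := by
  have h := congrArg (overlapLaurent k hl)
    (mul_invLeft (ChartRing.x _ _) (ChartRing.x _ _ - 1 : SideRing k n m l))
  rw [map_mul, map_one, overlapLaurent_algebraMap, sideLaurent_x] at h
  exact left_inv_eq_right_inv (by rw [mul_comm]; exact h)
    (by rw [mul_comm]; exact var_mul_invVar)

/-- Logarithmicity along x = 0 and x = 1 makes D x, restricted to y = 0, divisible by the coprime
polynomials x and x - 1. -/
lemma exists_sideLaurent_derivation {n m l : ℕ} (hn : (n : k) ≠ 0) (hm : (m : k) ≠ 0) (hl : l ≠ 0)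
    (D : SelfDerivation (SideRing k n m l)) :
    ∃ α : Polynomial k, sideLaurent k hl (D (ChartRing.x _ _)) =
      invVar k * (invVar k - 1) * Polynomial.aeval (invVar k) α := by
  have h0 : (Polynomial.X : Polynomial k) ∣ sideEval k hl (D (ChartRing.x _ _)) := by
    simpa [sideEval] using map_dvd (sideEval k hl) (side_dvd_x hm D)
  have h1 : (Polynomial.X - 1 : Polynomial k) ∣ sideEval k hl (D (ChartRing.x _ _)) := by
    simpa [sideEval] using map_dvd (sideEval k hl) (side_dvd_x_sub_one hn D)
  obtain ⟨α, hα⟩ := IsCoprime.mul_dvd ⟨1, -1, by ring⟩ h0 h1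
  refine ⟨α, ?_⟩
  change Polynomial.aeval (invVar k) (sideEval k hl (D (ChartRing.x _ _))) = _
  rw [hα]
  simp

/-- The logarithmic residue at the point at infinity of `E₁` or `E₃`. -/
lemma residue_of_edge {n m l : ℕ} (hn : (n : k) ≠ 0) (hm : (m : k) ≠ 0) (hl : l ≠ 0)
    {M : Type u} [CommRing M] [Algebra k M] (τ : M →ₐ[k] EndRing k n m l)
    (ψ : M →ₐ[k] PowerSeries k)
    (hψ : (overlapLaurent k hl).comp τ = (laurentOfPowerSeries k).comp ψ)
    {e w : M} (he : τ e = invLeft (ChartRing.x _ _) (ChartRing.x _ _ - 1 : SideRing k n m l))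
    {Ds : SelfDerivation (SideRing k n m l)} {Dt : SelfDerivation M}
    {Es Et : SelfDerivation (EndRing k n m l)}
    (hs : ∀ r, Es (algebraMap _ _ r) = algebraMap _ _ (Ds r)) (ht : ∀ r, Et (τ r) = τ (Dt r))
    {c : k} (hE : Es (algebraMap (SideRing k n m l) _ (ChartRing.x _ _)) -
      Et (algebraMap (SideRing k n m l) _ (ChartRing.x _ _)) =
        algebraMap k _ c * algebraMap (SideRing k n m l) _ (ChartRing.x _ _))
    (hw : Dt e = e * w) : ψ w = PowerSeries.C c := by
  obtain ⟨α, hα⟩ := exists_sideLaurent_derivation hn hm hl Ds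
  apply eq_C_of_edge (α := α)
  have h1 := mul_invLeft (ChartRing.x _ _) (ChartRing.x _ _ - 1 : SideRing k n m l)
  -- Differentiating x e = 1 gives e · Et x = -τ w, and Et x = Ds x - c x by `hE`.
  have h2 := congrArg Et h1
  rw [SelfDerivation.map_mul, SelfDerivation.map_one, ← he, ht, hw, map_mul, he] at h2
  rw [hs] at hE
  have h3 : invLeft (ChartRing.x _ _) (ChartRing.x _ _ - 1 : SideRing k n m l) *
      (algebraMap (SideRing k n m l) _ (Ds (ChartRing.x _ _)) -
        algebraMap k _ c * algebraMap (SideRing k n m l) _ (ChartRing.x _ _)) + τ w = 0 := by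
    linear_combination h2 + invLeft (ChartRing.x _ _) (ChartRing.x _ _ - 1 : SideRing k n m l) * hE
      - τ w * h1
  -- Restricting to the component y = 0 and expanding in 1/x turns the identity into the hypothesis
  -- of `eq_C_of_edge`.
  have h4 := congrArg (overlapLaurent k hl) h3
  rw [map_add, map_mul, map_sub, map_mul, map_zero, overlapLaurent_algebraMap,
    overlapLaurent_algebraMap, overlapLaurent_invLeft, hα, sideLaurent_x, AlgHom.commutes] at h4
  rw [← h4]
  congr 1
  exact (DFunLike.congr_fun hψ w).symm

variable {n m l q : ℕ}

/-- Restriction to E₁, where y = 0, makes w a power series in x, which `residue_of_edge` shows to be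
the constant c. Evaluation χ at the point E₁ ∩ E₂ is its constant coefficient. -/
lemma residue_mid₁ (hn : (n : k) ≠ 0) (hm : (m : k) ≠ 0) (hl : l ≠ 0) (b : ℕ)
    {Ds : SelfDerivation (SideRing k n m l)}
    {Dt : SelfDerivation (MidRing k (1 - X 0) q l)}
    {Es Et : SelfDerivation (EndRing k n m l)}
    (hs : ∀ r, Es (algebraMap _ _ r) = algebraMap _ _ (Ds r))
    (ht : ∀ r, Et (endTrans₁ k n m l q b r) = endTrans₁ k n m l q b (Dt r))
    {c : k} (hE : Es (algebraMap (SideRing k n m l) _ (ChartRing.x _ _)) -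
      Et (algebraMap (SideRing k n m l) _ (ChartRing.x _ _)) =
        algebraMap k _ c * algebraMap (SideRing k n m l) _ (ChartRing.x _ _))
    {w : MidRing k (1 - X 0) q l} (hw : Dt (ChartRing.x _ _) = ChartRing.x _ _ * w)
    (χ : MidRing k (1 - X 0) q l →ₐ[k] k) (hx : χ (ChartRing.x _ _) = 0)
    (hy : χ (ChartRing.y _ _) = 0) : χ w = c := by
  let ψ : MidRing k (1 - X 0) q l →ₐ[k] PowerSeries k :=
    ChartRing.lift PowerSeries.X 0 (by simp [hl]) (by simpa using isUnit_one_sub_X)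
  have h := residue_of_edge hn hm hl (endTrans₁ k n m l q b) ψ
    (ChartRing.algHom_ext
      (by simp [ψ, endTrans₁, overlapLaurent_invLeft])
      (by simp [ψ, endTrans₁, loc_apply, overlapLaurent_algebraMap, sideLaurent_y]))
    (ChartRing.lift_x _ _ _ _) hs ht hE hw
  have hχ : χ = (constCoeff k).comp ψ :=
    ChartRing.algHom_ext (by simp [ψ, hx, constCoeff_apply]) (by simp [ψ, hy])
  rw [hχ, AlgHom.comp_apply, h]
  simp [constCoeff_apply]

/-- The same argument on E₃, which is x = 0 in `mid₂`, so the coordinates exchange roles. -/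
lemma residue_mid₂ (hn : (n : k) ≠ 0) (hm : (m : k) ≠ 0) (hl : l ≠ 0) (b : ℕ)
    {Ds : SelfDerivation (SideRing k n m l)}
    {Dt : SelfDerivation (MidRing k (1 - X 1) l q)}
    {Es Et : SelfDerivation (EndRing k n m l)}
    (hs : ∀ r, Es (algebraMap _ _ r) = algebraMap _ _ (Ds r))
    (ht : ∀ r, Et (endTrans₂ k n m l q b r) = endTrans₂ k n m l q b (Dt r))
    {c : k} (hE : Es (algebraMap (SideRing k n m l) _ (ChartRing.x _ _)) -
      Et (algebraMap (SideRing k n m l) _ (ChartRing.x _ _)) =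
        algebraMap k _ c * algebraMap (SideRing k n m l) _ (ChartRing.x _ _))
    {w : MidRing k (1 - X 1) l q} (hw : Dt (ChartRing.y _ _) = ChartRing.y _ _ * w)
    (χ : MidRing k (1 - X 1) l q →ₐ[k] k) (hx : χ (ChartRing.x _ _) = 0)
    (hy : χ (ChartRing.y _ _) = 0) : χ w = c := by
  let ψ : MidRing k (1 - X 1) l q →ₐ[k] PowerSeries k :=
    ChartRing.lift 0 PowerSeries.X (by simp [hl]) (by simpa using isUnit_one_sub_X)
  have h := residue_of_edge hn hm hl (endTrans₂ k n m l q b) ψ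
    (ChartRing.algHom_ext
      (by simp [ψ, endTrans₂, loc_apply, overlapLaurent_algebraMap, sideLaurent_y])
      (by simp [ψ, endTrans₂, overlapLaurent_invLeft]))
    (ChartRing.lift_y _ _ _ _) hs ht hE hw
  have hχ : χ = (constCoeff k).comp ψ :=
    ChartRing.algHom_ext (by simp [ψ, hx]) (by simp [ψ, hy, constCoeff_apply])
  rw [hχ, AlgHom.comp_apply, h]
  simp [constCoeff_apply]

/-- In characteristic dividing the self-intersection number of `E₂`, the logarithmic residues at the
two points of intersection of `E₂` agree. -/
lemma residue_eq (hq : 2 ≤ q) {r b : ℕ} (hb : (b : k) = 0)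
    {D₁ : SelfDerivation (MidRing k (1 - X 0) q l)}
    {D₂ : SelfDerivation (MidRing k (1 - X 1) r q)}
    {E : SelfDerivation (Localization.Away (ChartRing.y _ _ : MidRing k (1 - X 0) q l))}
    (h₁ : ∀ r, E (algebraMap _ _ r) = algebraMap _ _ (D₁ r))
    (h₂ : ∀ s, E (midTrans k q l r b s) = midTrans k q l r b (D₂ s))
    {w₁ : MidRing k (1 - X 0) q l} (hw₁ : D₁ (ChartRing.x _ _) = ChartRing.x _ _ * w₁)
    {w₂ : MidRing k (1 - X 1) r q} (hw₂ : D₂ (ChartRing.y _ _) = ChartRing.y _ _ * w₂)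
    (χ₁ : MidRing k (1 - X 0) q l →ₐ[k] k) (hx₁ : χ₁ (ChartRing.x _ _) = 0)
    (hy₁ : χ₁ (ChartRing.y _ _) = 0)
    (χ₂ : MidRing k (1 - X 1) r q →ₐ[k] k) (hx₂ : χ₂ (ChartRing.x _ _) = 0)
    (hy₂ : χ₂ (ChartRing.y _ _) = 0) : χ₁ w₁ = χ₂ w₂ := by
  -- The maps ψ₁ and ψ₂ restrict functions to E₂: y₁ is a coordinate on its affine part in `mid₁`,
  -- and x₂ = 1/y₁ is the parameter at the other point.
  let ψ₁ : MidRing k (1 - X 0) q l →ₐ[k] Polynomial k :=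
    ChartRing.lift 0 Polynomial.X (by simp [show q ≠ 0 by omega]) (by simp)
  let ψ₂ : MidRing k (1 - X 1) r q →ₐ[k] PowerSeries k :=
    ChartRing.lift PowerSeries.X 0 (by simp [show q ≠ 0 by omega]) (by simp)
  have hε : (DualNumber.eps : DualNumber (LaurentSeries k)) ^ q = 0 := by
    obtain ⟨q, rfl⟩ := Nat.exists_eq_add_of_le hq
    rw [pow_add, pow_two, DualNumber.eps_mul_eps, zero_mul]
  let : Algebra k (DualNumber (LaurentSeries k)) :=
    ((TrivSqZeroExt.inlHom (LaurentSeries k) (LaurentSeries k)).comp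
      (algebraMap k (LaurentSeries k))).toAlgebra
  -- The relation obtained below is x (w₁ - w₂) = 0 with x nilpotent, so x cannot be cancelled.
  -- Sending x to ε, which is allowed because q ≥ 2, keeps what is needed: ε a = 0 forces the first
  -- component of a, its value on E₂, to vanish.
  let κ₁ : MidRing k (1 - X 0) q l →ₐ[k] DualNumber (LaurentSeries k) :=
    ChartRing.lift DualNumber.eps (TrivSqZeroExt.inl (invVar k)) (by simp [hε])
      (by simpa using IsNilpotent.isUnit_one_sub ⟨q, hε⟩)
  let κ : Localization.Away (ChartRing.y _ _ : MidRing k (1 - X 0) q l) →ₐ[k]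
      DualNumber (LaurentSeries k) := awayExt _ κ₁ (by
    rw [ChartRing.lift_y]
    exact isUnit_invVar.map (TrivSqZeroExt.inlHom _ _))
  have hκ : ∀ r, κ (algebraMap _ _ r) = κ₁ r := awayExt_algebraMap _ _ _
  obtain ⟨π, hπ⟩ : ∃ π : DualNumber (LaurentSeries k) →ₐ[k] LaurentSeries k,
      ∀ z, π z = z.fst :=
    ⟨{ (TrivSqZeroExt.fstHom (LaurentSeries k) (LaurentSeries k) (LaurentSeries k) :
        DualNumber (LaurentSeries k) →+* LaurentSeries k) with commutes' := fun _ => rfl },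
      fun _ => rfl⟩
  have hinv : κ (awayInv _) = TrivSqZeroExt.inl (laurentOfPowerSeries k PowerSeries.X) := by
    have h := congrArg κ (mul_awayInv (ChartRing.y _ _ : MidRing k (1 - X 0) q l))
    rw [map_mul, hκ, map_one, ChartRing.lift_y] at h
    refine left_inv_eq_right_inv (by rw [mul_comm]; exact h) ?_
    rw [← TrivSqZeroExt.inl_mul, mul_comm, var_mul_invVar, TrivSqZeroExt.inl_one]
  have e₁ : π.comp κ₁ = (Polynomial.aeval (invVar k)).comp ψ₁ :=
    ChartRing.algHom_ext (by simp [κ₁, ψ₁, hπ]) (by simp [κ₁, ψ₁, hπ])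
  have e₂ : (π.comp κ).comp (midTrans k q l r b) = (laurentOfPowerSeries k).comp ψ₂ :=
    ChartRing.algHom_ext (by simp [midTrans, ψ₂, hinv, hπ])
      (by simp [midTrans, ψ₂, hκ, loc_apply, κ₁, hπ])
  have f₁ : χ₁ = (constCoeff k).comp ((Polynomial.aeval (0 : PowerSeries k)).comp ψ₁) :=
    ChartRing.algHom_ext (by simp [ψ₁, hx₁]) (by simp [ψ₁, hy₁])
  have f₂ : χ₂ = (constCoeff k).comp ψ₂ :=
    ChartRing.algHom_ext (by simp [ψ₂, hx₂, constCoeff_apply]) (by simp [ψ₂, hy₂])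
  -- Apply the derivation to y₂ = x₁ y₁ ^ b: the derivative of y₁ ^ b has the factor b = 0, and the
  -- unit y₁ ^ b cancels.
  have key : algebraMap (MidRing k (1 - X 0) q l) (Localization.Away (ChartRing.y _ _))
      (ChartRing.x _ _) * (algebraMap _ _ w₁ - midTrans k q l r b w₂) = 0 := by
    have hy : midTrans k q l r b (ChartRing.y _ _) =
      algebraMap _ _ (ChartRing.x _ _) * algebraMap _ _ (ChartRing.y _ _) ^ b :=
        ChartRing.lift_y _ _ _ _
    have h := h₂ (ChartRing.y _ _)
    have hb' : (b : Localization.Away (ChartRing.y _ _ : MidRing k (1 - X 0) q l)) = 0 := by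
      rw [← map_natCast (algebraMap k _), hb, map_zero]
    rw [hw₂, map_mul, hy, SelfDerivation.map_mul, SelfDerivation.map_pow, h₁ (ChartRing.x _ _),
      hw₁, map_mul] at h
    simp only [hb', zero_mul, mul_zero, zero_add] at h
    refine eq_zero_of_unit ((IsUnit.of_mul_eq_one _ (mul_awayInv
      (ChartRing.y _ _ : MidRing k (1 - X 0) q l))).pow b) ?_
    linear_combination h
  have key' := congrArg κ key
  rw [map_mul, map_sub, hκ, hκ, map_zero, ChartRing.lift_x, mul_comm] at key'
  have h3 : π (κ₁ w₁) = π (κ (midTrans k q l r b w₂)) := by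
    have := congrArg TrivSqZeroExt.snd key'
    simpa [hπ, sub_eq_zero] using this
  -- On E₂ the polynomial of w₁ in 1/z equals the power series of w₂ in z, so both are constant.
  have h4 := (DFunLike.congr_fun e₁ w₁).symm.trans (h3.trans (DFunLike.congr_fun e₂ w₂))
  have h5 : ψ₁ w₁ = Polynomial.C (constCoeff k (ψ₂ w₂)) := (eq_const_of_aeval_eq h4).1
  rw [f₁, f₂]
  change constCoeff k (Polynomial.aeval 0 (ψ₁ w₁)) = constCoeff k (ψ₂ w₂)
  rw [h5, Polynomial.aeval_C, AlgHom.commutes]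
  rfl

end Compatible

end Plumbing

/-! ### From vector fields to derivations of coordinate rings -/

namespace Tangent

noncomputable section

section Immersion

variable {X : Scheme.{u}} {A B : Type u} [CommRing A] [CommRing B]

/-- The functions on the image of an open immersion `Spec A ⟶ X`. -/
def immFun (j : Spec (.of A) ⟶ X) [IsOpenImmersion j] : A ≃+* Γ(X, j ''ᵁ ⊤) :=
  ((Scheme.ΓSpecIso (.of A)).symm ≪≫ (j.appIso ⊤).symm).commRingCatIsoToRingEquiv

lemma immFun_apply (j : Spec (.of A) ⟶ X) [IsOpenImmersion j] (a : A) :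
    immFun j a = (j.appIso ⊤).inv ((Scheme.ΓSpecIso (.of A)).inv a) := rfl

lemma appLE_immFun (j : Spec (.of A) ⟶ X) [IsOpenImmersion j] (h : ⊤ ≤ j ⁻¹ᵁ j ''ᵁ ⊤) (a : A) :
    j.appLE (j ''ᵁ ⊤) ⊤ h (immFun j a) = (Scheme.ΓSpecIso (.of A)).inv a := by
  rw [immFun_apply, ← CommRingCat.comp_apply, Scheme.Hom.appIso_inv_appLE]
  simp

lemma appLE_injective (j : Spec (.of A) ⟶ X) [IsOpenImmersion j] (h : ⊤ ≤ j ⁻¹ᵁ j ''ᵁ ⊤) :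
    Function.Injective (j.appLE (j ''ᵁ ⊤) ⊤ h) := by
  rw [← Scheme.Hom.appIso_hom']
  exact (ConcreteCategory.bijective_of_isIso (j.appIso ⊤).hom).1

lemma image_le {j : Spec (.of A) ⟶ X} [IsOpenImmersion j] {j' : Spec (.of B) ⟶ X}
    [IsOpenImmersion j'] {φ : A →+* B} (hφ : Spec.map (CommRingCat.ofHom φ) ≫ j = j') :
    j' ''ᵁ ⊤ ≤ j ''ᵁ ⊤ := by
  subst hφ
  rintro _ ⟨x, -, rfl⟩
  exact ⟨_, trivial, rfl⟩

lemma resFun_immFun {j : Spec (.of A) ⟶ X} [IsOpenImmersion j] {j' : Spec (.of B) ⟶ X}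
    [IsOpenImmersion j'] {φ : A →+* B} (hφ : Spec.map (CommRingCat.ofHom φ) ≫ j = j')
    (h : j' ''ᵁ ⊤ ≤ j ''ᵁ ⊤) (a : A) : resFun h (immFun j a) = immFun j' (φ a) := by
  apply appLE_injective j' (by simp)
  rw [appLE_immFun, resFun]
  change (X.presheaf.map (homOfLE h).op ≫ j'.appLE (j' ''ᵁ ⊤) ⊤ _) (immFun j a) = _
  rw [Scheme.Hom.map_appLE]
  subst hφ
  have h1 : ∀ e, (Spec.map (CommRingCat.ofHom φ) ≫ j).appLE (j ''ᵁ ⊤) ⊤ e =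
      j.appLE (j ''ᵁ ⊤) ⊤ (by simp) ≫ (Spec.map (CommRingCat.ofHom φ)).appLE ⊤ ⊤ le_top :=
    fun _ => (Scheme.Hom.appLE_comp_appLE _ _ _ _ _ _ _).symm
  have h2 : (Spec.map (CommRingCat.ofHom φ)).appLE ⊤ ⊤ le_top =
      (Spec.map (CommRingCat.ofHom φ)).appTop := Scheme.Hom.appLE_eq_app _
  rw [h1, CommRingCat.comp_apply, appLE_immFun, h2, ← CommRingCat.comp_apply,
    ← Scheme.ΓSpecIso_inv_naturality]
  rfl

variable {k : Type u} [Field k] {f : X ⟶ Spec (.of k)}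

lemma immFun_algebraMap [Algebra k A] (j : Spec (.of A) ⟶ X) [IsOpenImmersion j]
    (hj : j ≫ f = Spec.map (CommRingCat.ofHom (algebraMap k A))) (c : k) :
    immFun j (algebraMap k A c) = (sectionAlgebra f (j ''ᵁ ⊤)).algebraMap c := by
  apply appLE_injective j (by simp)
  rw [appLE_immFun]
  change _ = (f.appTop ≫ X.presheaf.map _ ≫ j.appLE (j ''ᵁ ⊤) ⊤ _)
    ((Scheme.ΓSpecIso (.of k)).inv c)
  have h2 : ∀ e, j.appLE ⊤ ⊤ e = j.appTop := fun _ => Scheme.Hom.appLE_eq_app _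
  rw [Scheme.Hom.map_appLE, h2, ← Scheme.Hom.comp_appTop, hj, ← CommRingCat.comp_apply,
    ← Scheme.ΓSpecIso_inv_naturality]
  rfl

variable {U : X.Opens}

/-- The derivation of the functions on `V` given by a vector field. -/
def actDer (θ : tangentSections f U) {V : X.Opens} (h : V ≤ U) : SelfDerivation Γ(X, V) :=
  selfDerivation (act θ h) (fun a b => by simp [act, dif_add]) (fun a b => by
    simp [act, dif_mul])

/-- The derivation of `A` given by a vector field on a neighbourhood of the image of `Spec A`. -/
def immDer (θ : tangentSections f U) (j : Spec (.of A) ⟶ X) [IsOpenImmersion j]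
    (h : j ''ᵁ ⊤ ≤ U) : SelfDerivation A :=
  selfDerivation (fun a => (immFun j).symm (actDer θ h (immFun j a))) (fun a b => by simp)
    (fun a b => by simp)

lemma immFun_immDer (θ : tangentSections f U) (j : Spec (.of A) ⟶ X) [IsOpenImmersion j]
    (h : j ''ᵁ ⊤ ≤ U) (a : A) : immFun j (immDer θ j h a) = act θ h (immFun j a) :=
  (immFun j).apply_symm_apply _

/-- Vector fields commute with restriction, and restriction of functions between images of affine
schemes is the ring map φ. Every compatibility between charts used in the residue argument comes
from here. -/
lemma immDer_map (θ : tangentSections f U) {j : Spec (.of A) ⟶ X} [IsOpenImmersion j]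
    {j' : Spec (.of B) ⟶ X} [IsOpenImmersion j'] {φ : A →+* B}
    (hφ : Spec.map (CommRingCat.ofHom φ) ≫ j = j') (h : j ''ᵁ ⊤ ≤ U) (h' : j' ''ᵁ ⊤ ≤ U) (a : A) :
    immDer θ j' h' (φ a) = φ (immDer θ j h a) := by
  apply (immFun j').injective
  rw [immFun_immDer, ← resFun_immFun hφ (image_le hφ), ← resFun_immFun hφ (image_le hφ),
    immFun_immDer, act_res]

end Immersion

end

end Tangent

/-! ### Vector fields on affine open sets -/

namespace Tangent

noncomputable section

section Localization

variable {A B C : Type u} [CommRing A] [CommRing B] [CommRing C]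

/-- The ring map a ↦ a + ε D a into the dual numbers sends g to a unit, because its first component
is one, and so extends to the localization. -/
lemma exists_derivation_of_away (ι : A →+* B) (g : A)
    (hι : @IsLocalization.Away A _ g B _ ι.toAlgebra) (D : SelfDerivation A) :
    ∃ D' : SelfDerivation B, ∀ a, D' (ι a) = ι (D a) := by
  let := ι.toAlgebra
  let Φ : A →+* DualNumber B :=
    { toFun := fun a => TrivSqZeroExt.inl (ι a) + TrivSqZeroExt.inr (ι (D a))
      map_one' := by ext <;> simp
      map_zero' := by ext <;> simp
      map_add' := fun a b => by ext <;> simp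
      map_mul' := fun a b => by ext <;> simp [mul_comm] }
  have hg : IsUnit (Φ g) := by
    rw [TrivSqZeroExt.isUnit_iff_isUnit_fst]
    have h : IsUnit (ι g) := IsLocalization.Away.algebraMap_isUnit (S := B) g
    simpa [Φ] using h
  let Ψ : B →+* DualNumber B := IsLocalization.Away.lift g hg
  have hΨ : ∀ a, Ψ (ι a) = Φ a := IsLocalization.Away.lift_eq g hg
  have h1 : ∀ b, (Ψ b).fst = b := by
    have : ((TrivSqZeroExt.fstHom B B B : DualNumber B →ₐ[B] B) : DualNumber B →+* B).comp Ψ =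
        RingHom.id B := by
      apply IsLocalization.ringHom_ext (Submonoid.powers g)
      ext a
      change (Ψ (ι a)).fst = ι a
      rw [hΨ]
      simp [Φ]
    exact DFunLike.congr_fun this
  refine ⟨derivationOfDual Ψ h1, fun a => ?_⟩
  rw [derivationOfDual_apply, hΨ]
  simp [Φ]

/-- The quotient rule: with b g ^ n in the image of A, the value on b is determined after cancelling
the unit g ^ n. For ρ the identity this is uniqueness of the extension. -/
lemma derivation_comm_of_away (ι : A →+* B) (g : A)
    (hι : @IsLocalization.Away A _ g B _ ι.toAlgebra) (ρ : B →+* C) {D : SelfDerivation B}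
    {D' : SelfDerivation C} (h : ∀ a, D' (ρ (ι a)) = ρ (D (ι a))) (b : B) :
    D' (ρ b) = ρ (D b) := by
  let := ι.toAlgebra
  obtain ⟨n, a, ha⟩ := IsLocalization.Away.surj g b
  replace ha : b * ι g ^ n = ι a := ha
  have hu : IsUnit (ρ (ι g) ^ n) :=
    ((IsLocalization.Away.algebraMap_isUnit (S := B) g).map ρ).pow n
  have h1 := h a
  have h2 := h (g ^ n)
  rw [map_pow, map_pow] at h2
  rw [← ha, map_mul, D'.leibniz, D.leibniz, map_pow, h2] at h1
  simp only [smul_eq_mul, map_add, map_mul, map_pow] at h1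
  apply hu.mul_left_cancel
  linear_combination h1

end Localization

section Affine

variable {k : Type u} [Field k] {X : Scheme.{u}} {f : X ⟶ Spec (.of k)} {U : X.Opens}

lemma resFun_self {V : X.Opens} (a : Γ(X, V)) : resFun le_rfl a = a := by
  change (X.presheaf.map (𝟙 _)) a = a
  simp

lemma away_resFun (hU : IsAffineOpen U) (g : Γ(X, U)) :
    @IsLocalization.Away _ _ g _ _ (resFun (X.basicOpen_le g)).toAlgebra :=
  hU.isLocalization_of_eq_basicOpen g (homOfLE (X.basicOpen_le g)) rfl

lemma le_iSup_basicOpen (hU : IsAffineOpen U) {V : X.Opens} (hV : V ≤ U) :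
    V ≤ ⨆ g : {g : Γ(X, U) // X.basicOpen g ≤ V}, X.basicOpen g.1 := by
  intro x hx
  obtain ⟨g, hg, hxg⟩ := hU.exists_basicOpen_le ⟨x, hx⟩ (hV hx)
  exact Opens.mem_iSup.2 ⟨⟨g, hg⟩, hxg⟩

lemma fun_ext_basicOpen (hU : IsAffineOpen U) {V : X.Opens} (hV : V ≤ U) {a b : Γ(X, V)}
    (h : ∀ (g : Γ(X, U)) (hg : X.basicOpen g ≤ V), resFun hg a = resFun hg b) : a = b :=
  X.sheaf.eq_of_locally_eq' (fun g : {g : Γ(X, U) // X.basicOpen g ≤ V} => X.basicOpen g.1) V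
    (fun g => homOfLE g.2) (le_iSup_basicOpen hU hV) a b (fun g => h g.1 g.2)

/-- A vector field on an affine open set is determined by its values on functions there. -/
lemma tangent_ext_affine (hU : IsAffineOpen U) {θ η : tangentSections f U}
    (h : ∀ a : Γ(X, U), act θ le_rfl a = act η le_rfl a) : θ = η := by
  apply tangent_ext
  intro V hV a
  apply fun_ext_basicOpen hU hV
  intro g hg
  rw [act_res, act_res]
  have hD := X.basicOpen_le g
  refine derivation_comm_of_away _ g (away_resFun hU g) (RingHom.id _)
    (D := actDer η (hg.trans hV)) (D' := actDer θ (hg.trans hV)) (fun b => ?_) (resFun hg a)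
  change act θ hD (resFun hD b) = act η hD (resFun hD b)
  rw [← act_res θ le_rfl, ← act_res η le_rfl, h]

/-- A derivation of the functions on an affine open set gives a vector field. -/
lemma exists_tangentSection (hU : IsAffineOpen U) (D : SelfDerivation Γ(X, U))
    (hD : ∀ c : k, D ((sectionAlgebra f U).algebraMap c) = 0) :
    ∃ θ : tangentSections f U, ∀ a, act θ le_rfl a = D a := by
  -- E g extends D to the basic open set of g; uniqueness of extensions makes these compatible.
  choose E hE using fun g => exists_derivation_of_away _ g (away_resFun hU g) D
  have hEE : ∀ (g h : Γ(X, U)) (hgh : X.basicOpen h ≤ X.basicOpen g) (b : Γ(X, X.basicOpen g)),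
      E h (resFun hgh b) = resFun hgh (E g b) := by
    intro g h hgh
    refine derivation_comm_of_away _ g (away_resFun hU g) (resFun hgh) (fun b => ?_)
    rw [hE, resFun_resFun, resFun_resFun, hE]
  -- On an open set V that need not be affine, the value is glued from the basic open sets contained
  -- in V.
  have key : ∀ (V : {V : X.Opens // V ≤ U}) (a : Γ(X, V.1)), ∃ b : Γ(X, V.1),
      ∀ (g : Γ(X, U)) (hg : X.basicOpen g ≤ V.1), resFun hg b = E g (resFun hg a) := by
    intro V a
    obtain ⟨b, hb, -⟩ := X.sheaf.existsUnique_gluing'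
      (fun g : {g : Γ(X, U) // X.basicOpen g ≤ V.1} => X.basicOpen g.1) V.1
      (fun g => homOfLE g.2) (le_iSup_basicOpen hU V.2) (fun g => E g.1 (resFun g.2 a)) (by
        intro g h
        -- The intersection is the basic open set of the product, where both values are given by E
        -- (g h).
        have hle : X.basicOpen g.1 ⊓ X.basicOpen h.1 ≤ X.basicOpen (g.1 * h.1) :=
          (X.basicOpen_mul _ _).ge
        have hg : X.basicOpen (g.1 * h.1) ≤ X.basicOpen g.1 :=
          (X.basicOpen_mul _ _).le.trans inf_le_left
        have hh : X.basicOpen (g.1 * h.1) ≤ X.basicOpen h.1 :=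
          (X.basicOpen_mul _ _).le.trans inf_le_right
        change resFun inf_le_left (E g.1 (resFun g.2 a)) =
          resFun inf_le_right (E h.1 (resFun h.2 a))
        rw [← resFun_resFun hg hle, ← resFun_resFun hh hle, ← hEE, ← hEE, resFun_resFun,
          resFun_resFun])
    exact ⟨b, fun g hg => hb ⟨g, hg⟩⟩
  choose F hF using key
  have hφ : ∀ V : {V : X.Opens // V ≤ U}, ∃ φ : Kahler f V.1 →ₗ[Γ(X, V.1)] Γ(X, V.1),
      ∀ a, φ (dif f V.1 a) = F V a := by
    intro V
    apply exists_hom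
    · intro a b
      apply fun_ext_basicOpen hU V.2
      intro g hg
      simp only [map_add, hF]
    · intro a b
      apply fun_ext_basicOpen hU V.2
      intro g hg
      simp only [map_add, map_mul, hF, Derivation.leibniz, smul_eq_mul]
    · intro c
      apply fun_ext_basicOpen hU V.2
      intro g hg
      rw [hF, resFun_algebraMap (f := f), ← resFun_algebraMap (f := f) (X.basicOpen_le g), hE, hD,
        map_zero, map_zero]
  choose φ hφ using hφ
  refine ⟨⟨φ, ?_⟩, ?_⟩
  · intro V W h a
    rw [hφ, hφ]
    apply fun_ext_basicOpen hU W.2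
    intro g hg
    rw [hF, resFun_resFun, resFun_resFun, hF]
  · intro a
    change φ ⟨U, le_rfl⟩ (dif f U a) = D a
    rw [hφ]
    apply fun_ext_basicOpen hU le_rfl
    intro g hg
    exact (hF ⟨U, le_rfl⟩ a g hg).trans (hE g a)

end Affine

end

end Tangent

/-! ### A Mayer–Vietoris criterion for nonvanishing of H¹ -/

namespace MayerVietoris

noncomputable section

open Limits Abelian

variable {X : Type u} [TopologicalSpace X]

/-- The presheaf of free abelian groups represented by an open set. -/
abbrev freePresheaf (U : Opens X) : (Opens X)ᵒᵖ ⥤ AddCommGrpCat.{u} :=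
  yoneda.obj U ⋙ AddCommGrpCat.free

/-- The sheaf of abelian groups that is freely generated by a section over an open set. -/
abbrev freeSheaf (U : Opens X) : Sheaf (Opens.grothendieckTopology X) AddCommGrpCat.{u} :=
  (presheafToSheaf _ _).obj (freePresheaf U)

/-- The map of free sheaves given by an inclusion of open sets. -/
abbrev freeMap {U V : Opens X} (i : U ⟶ V) : freeSheaf U ⟶ freeSheaf V :=
  (presheafToSheaf _ _).map (Functor.whiskerRight (yoneda.map i) _)

variable {F : Sheaf (Opens.grothendieckTopology X) AddCommGrpCat.{u}}

/-- The image of the generating section. -/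
def evalGen {U : Opens X} (φ : freeSheaf U ⟶ F) : F.obj.obj (op U) :=
  ((sheafificationAdjunction _ _).homEquiv _ _ φ).app (op U) (FreeAbelianGroup.of (𝟙 U))

/-- In this form additivity in φ is definitional. -/
lemma evalGen_eq {U : Opens X} (φ : freeSheaf U ⟶ F) : evalGen φ =
    φ.hom.app (op U) ((toSheafify _ (freePresheaf U)).app (op U) (FreeAbelianGroup.of (𝟙 U))) := by
  rw [evalGen, Adjunction.homEquiv_unit]
  rfl

lemma evalGen_add {U : Opens X} (φ ψ : freeSheaf U ⟶ F) :
    evalGen (φ + ψ) = evalGen φ + evalGen ψ := by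
  simp only [evalGen_eq]
  rfl

lemma evalGen_neg {U : Opens X} (φ : freeSheaf U ⟶ F) : evalGen (-φ) = -evalGen φ := by
  simp only [evalGen_eq]
  rfl

lemma evalGen_freeMap {U V : Opens X} (i : U ⟶ V) (φ : freeSheaf V ⟶ F) :
    evalGen (freeMap i ≫ φ) = F.obj.map i.op (evalGen φ) := by
  unfold evalGen
  rw [Adjunction.homEquiv_naturality_left]
  set η := (sheafificationAdjunction (Opens.grothendieckTopology X) AddCommGrpCat.{u}).homEquiv
    _ _ φ
  have h := ConcreteCategory.congr_hom (η.naturality i.op) (FreeAbelianGroup.of (𝟙 V))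
  refine Eq.trans ?_ h
  change η.app (op U) _ = η.app (op U) _
  congr 1

/-- The Yoneda lemma combined with the universal properties of free abelian groups and of
sheafification: s defines the map that sends an inclusion into U to the restriction of s. -/
lemma evalGen_surjective (U : Opens X) (s : F.obj.obj (op U)) :
    ∃ φ : freeSheaf U ⟶ F, evalGen φ = s := by
  let η : freePresheaf U ⟶ F.obj :=
    { app := fun V => AddCommGrpCat.ofHom
        (FreeAbelianGroup.lift (fun i : V.unop ⟶ U => F.obj.map i.op s))
      naturality := by
        intro V W j
        apply AddCommGrpCat.hom_ext
        apply FreeAbelianGroup.lift_ext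
        intro x
        change FreeAbelianGroup.lift _ (FreeAbelianGroup.map _ (FreeAbelianGroup.of x)) =
          F.obj.map j (FreeAbelianGroup.lift _ (FreeAbelianGroup.of x))
        rw [FreeAbelianGroup.map_of_apply, FreeAbelianGroup.lift_apply_of,
          FreeAbelianGroup.lift_apply_of, ← AddCommGrpCat.comp_apply, ← Functor.map_comp]
        rfl }
  refine ⟨((sheafificationAdjunction _ _).homEquiv _ _).symm η, ?_⟩
  rw [evalGen, Equiv.apply_symm_apply]
  change FreeAbelianGroup.lift _ (FreeAbelianGroup.of (𝟙 U)) = s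
  rw [FreeAbelianGroup.lift_apply_of]
  simp

/-- The constant sheaf is freely generated by a global section. -/
def freeSheafTopIso : freeSheaf (⊤ : Opens X) ≅
    (constantSheaf (Opens.grothendieckTopology X) AddCommGrpCat.{u}).obj (.of (ULift ℤ)) :=
  (presheafToSheaf _ _).mapIso (NatIso.ofComponents (fun V =>
    have : Unique (V.unop ⟶ (⊤ : Opens X)) := ⟨⟨homOfLE le_top⟩, fun _ => Subsingleton.elim _ _⟩
    ((FreeAbelianGroup.uniqueEquiv _).trans AddEquiv.ulift.symm).toAddCommGrpIso) (by
      intro V W j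
      apply AddCommGrpCat.hom_ext
      apply FreeAbelianGroup.lift_ext
      intro x
      rfl))

lemma biprod_lift_comp {C : Type*} [Category* C] [Preadditive C] {W Y Z T : C}
    [HasBinaryBiproduct Y Z] (a : W ⟶ Y) (b : W ⟶ Z) (ψ : Y ⊞ Z ⟶ T) :
    biprod.lift a b ≫ ψ = a ≫ biprod.inl ≫ ψ + b ≫ biprod.inr ≫ ψ := by
  rw [biprod.lift_eq, Preadditive.add_comp, Category.assoc, Category.assoc]

/-- If a section over `U ∩ V` is not a difference of sections over `U` and `V`, then the first
cohomology group does not vanish. -/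
theorem nontrivial_H1 {U V : Opens X} (hUV : U ⊔ V = ⊤) (s : F.obj.obj (op (U ⊓ V)))
    (hs : ∀ (a : F.obj.obj (op U)) (b : F.obj.obj (op V)),
      F.obj.map (homOfLE inf_le_left : U ⊓ V ⟶ U).op a -
        F.obj.map (homOfLE inf_le_right : U ⊓ V ⟶ V).op b ≠ s) : Nontrivial (Sheaf.H F 1) := by
  by_contra hn
  rw [not_nontrivial_iff_subsingleton] at hn
  let S := Opens.mayerVietorisSquare U V
  have h4 : S.X₄ = ⊤ := hUV
  -- H¹ is Ext¹ from the constant sheaf ℤ, which is isomorphic to the free sheaf on U ⊔ V = ⊤, the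
  -- last term of the Mayer–Vietoris sequence.
  have hsub : ∀ x : Ext S.shortComplex.X₃ F 1, x = 0 := by
    intro x
    let e : S.shortComplex.X₃ ≅ (constantSheaf _ AddCommGrpCat.{u}).obj (.of (ULift ℤ)) :=
      eqToIso (congrArg freeSheaf h4) ≪≫ freeSheafTopIso
    have h : (Ext.mk₀ e.inv).comp x (zero_add 1) = 0 := hn.elim _ _
    have h' := congrArg (fun y => (Ext.mk₀ e.hom).comp y (zero_add 1)) h
    simpa using h'
  -- As Ext¹ vanishes, the map φ of the free sheaf on U ⊓ V that represents s factors through the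
  -- sum of the free sheaves on U and V. The two components of the factorization are sections with
  -- difference s.
  obtain ⟨φ, hφ⟩ := evalGen_surjective _ s
  obtain ⟨y, hy⟩ := Ext.contravariant_sequence_exact₁ S.shortComplex_shortExact F (n₀ := 0)
    (Ext.mk₀ φ) (n₁ := 1) rfl (hsub _)
  obtain ⟨ψ, rfl⟩ := (Ext.mk₀_bijective _ _).2 y
  rw [Ext.mk₀_comp_mk₀] at hy
  replace hy := (Ext.mk₀_bijective _ _).1 hy
  refine hs (evalGen (biprod.inl ≫ ψ)) (evalGen (biprod.inr ≫ ψ)) ?_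
  rw [← hφ, ← hy, ← evalGen_freeMap, ← evalGen_freeMap, sub_eq_add_neg, ← evalGen_neg,
    ← evalGen_add]
  congr 1
  -- The first map of the Mayer–Vietoris sequence carries a minus sign in its second component.
  rw [← Preadditive.neg_comp]
  exact (biprod_lift_comp _ _ ψ).symm

end

end MayerVietoris

/-! ### Intersections of the charts in the plumbing scheme -/

namespace Plumbing

noncomputable section

section Intersections

open Limits Tangent

variable {k : Type u} [Field k] (b ν : Fin 7 → ℕ)

/-- The inclusion of an overlap of two charts. -/
def overlapMap (k : Type u) [Field k] (b ν : Fin 7 → ℕ) (o : Overlap) :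
    Spec (.of (OverlapRing k ν o)) ⟶ scheme k b ν :=
  Spec.map (CommRingCat.ofHom (algebraMap (CoordRing k ν (src o)) (OverlapRing k ν o))) ≫
    chartMap k b ν (src o)

instance (o : Overlap) : IsOpenImmersion (overlapMap k b ν o) := by
  unfold overlapMap
  infer_instance

lemma overlapMap_eq (o : Overlap) : Spec.map (CommRingCat.ofHom (transition k b ν o).toRingHom) ≫
    chartMap k b ν (tgt o) = overlapMap k b ν o :=
  (Multicoequalizer.condition (diagram k b ν) o).symm

lemma overlapMap_eq_ι (o : Overlap) :
    colimit.ι (diagram k b ν).multispan (.left o) = overlapMap k b ν o :=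
  (colimit.w (diagram k b ν).multispan (WalkingMultispan.Hom.fst (J := shape) o)).symm

lemma overlapMap_le_src (o : Overlap) :
    overlapMap k b ν o ''ᵁ ⊤ ≤ chartOpen k b ν (src o) := image_le rfl

lemma overlapMap_le_tgt (o : Overlap) :
    overlapMap k b ν o ''ᵁ ⊤ ≤ chartOpen k b ν (tgt o) := image_le (overlapMap_eq b ν o)

/-- The gluing diagram is locally directed, so points of two charts are identified only if they come
from a common point of an object mapping to both. For distinct charts such an object is an overlap.
-/
lemma exists_overlap {c c' : Chart} (h : c ≠ c') {z : scheme k b ν} (hc : z ∈ chartOpen k b ν c)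
    (hc' : z ∈ chartOpen k b ν c') : ∃ o, z ∈ overlapMap k b ν o ''ᵁ ⊤ ∧
      ((src o = c ∧ tgt o = c') ∨ (src o = c' ∧ tgt o = c)) := by
  obtain ⟨x, -, hx⟩ := hc
  obtain ⟨x', -, hx'⟩ := hc'
  have hxx : colimit.ι (diagram k b ν).multispan (.right c) x =
      colimit.ι (diagram k b ν).multispan (.right c') x' := hx.trans hx'.symm
  obtain ⟨i, fi, fj, y, hy, hy'⟩ := Scheme.IsLocallyDirected.ι_eq_ι_iff _ |>.1 hxx
  rcases i with o | d
  · refine ⟨o, ⟨y, trivial, ?_⟩, ?_⟩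
    · rw [← hx, ← overlapMap_eq_ι]
      change _ = colimit.ι (diagram k b ν).multispan (.right c) x
      rw [← hy, ← Scheme.Hom.comp_apply, colimit.w]
      rfl
    · change WalkingMultispan.Hom _ _ at fi fj
      rcases fi with _ | _ | _ <;> rcases fj with _ | _ | _
      · exact absurd rfl h
      · exact Or.inl ⟨rfl, rfl⟩
      · exact Or.inr ⟨rfl, rfl⟩
      · exact absurd rfl h
  · change WalkingMultispan.Hom _ _ at fi fj
    cases fi
    cases fj
    exact absurd rfl h

lemma exists_chart (z : scheme k b ν) : ∃ c, z ∈ chartOpen k b ν c := by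
  obtain ⟨i, x, rfl⟩ := Scheme.IsLocallyDirected.ι_jointly_surjective
    (diagram k b ν).multispan z
  rcases i with o | c
  · refine ⟨src o, overlapMap_le_src b ν o ⟨x, trivial, ?_⟩⟩
    rw [← overlapMap_eq_ι]
    rfl
  · exact ⟨c, x, trivial, rfl⟩

theorem iSup_cover : iSup (cover k b ν) = ⊤ := by
  rw [eq_top_iff]
  rintro z -
  obtain ⟨c, hc⟩ := exists_chart b ν z
  have h0 : chartOpen k b ν .left ⊔ chartOpen k b ν .e₄ ⊔ chartOpen k b ν .e₅ ≤
    iSup (cover k b ν) := le_iSup (cover k b ν) 0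
  have h1 : chartOpen k b ν .mid₁ ⊔ chartOpen k b ν .mid₂ ≤ iSup (cover k b ν) :=
    le_iSup (cover k b ν) 1
  have h2 : chartOpen k b ν .right ⊔ chartOpen k b ν .e₆ ⊔ chartOpen k b ν .e₇ ≤
    iSup (cover k b ν) := le_iSup (cover k b ν) 2
  simp only [sup_le_iff] at h0 h1 h2
  cases c
  exacts [h0.1.1 hc, h1.1 hc, h1.2 hc, h2.1.1 hc, h0.1.2 hc, h0.2 hc, h2.1.2 hc, h2.2 hc]

/-- No overlap joins a chart of U₀ to a chart of U₂. -/
theorem cover_zero_inf_two : cover k b ν 0 ⊓ cover k b ν 2 = ⊥ := by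
  rw [eq_bot_iff]
  rintro z ⟨h0, h2⟩
  exfalso
  rcases h0 with (h0 | h0) | h0 <;> rcases h2 with (h2 | h2) | h2 <;>
  · obtain ⟨o, -, h | h⟩ := exists_overlap b ν (by simp) h0 h2 <;> cases o <;> simp at h

/-- Only the overlap of `right` and `mid₂` joins a chart of U₁ to a chart of U₂. The intersection is
therefore affine, with ring `OverlapRing`. -/
theorem cover_one_inf_two :
    cover k b ν 1 ⊓ cover k b ν 2 = overlapMap k b ν .right_mid₂ ''ᵁ ⊤ := by
  apply le_antisymm
  · rintro z ⟨h1, h2⟩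
    rcases h1 with h1 | h1 <;> rcases h2 with (h2 | h2) | h2 <;>
    · obtain ⟨o, ho, h | h⟩ := exists_overlap b ν (by simp) h1 h2 <;> cases o <;>
        first | exact ho | simp at h
  · refine le_inf ((overlapMap_le_tgt b ν .right_mid₂).trans ?_)
      ((overlapMap_le_src b ν .right_mid₂).trans ?_)
    · exact le_sup_right
    · exact le_sup_left.trans le_sup_left

lemma chartMap_structureMap (c : Chart) : chartMap k b ν c ≫ structureMap k b ν =
    Spec.map (CommRingCat.ofHom (algebraMap k (CoordRing k ν c))) :=
  Multicoequalizer.π_desc _ _ _ _ _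

lemma overlapMap_structureMap (o : Overlap) : overlapMap k b ν o ≫ structureMap k b ν =
    Spec.map (CommRingCat.ofHom (algebraMap k (OverlapRing k ν o))) := by
  rw [overlapMap, Category.assoc, chartMap_structureMap, ← Spec.map_comp, ← CommRingCat.ofHom_comp,
    ← IsScalarTower.algebraMap_eq]

lemma chartFun_eq (c : Chart) (r : CoordRing k ν c) :
    chartFun k b ν c r = immFun (chartMap k b ν c) r := rfl

end Intersections

end

end Plumbing

/-! ### Vector fields on the image of an affine scheme -/

namespace Tangent

noncomputable section

variable {k : Type u} [Field k] {X : Scheme.{u}} {f : X ⟶ Spec (.of k)} {U : X.Opens}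
  {A : Type u} [CommRing A] [Algebra k A]

lemma immDer_algebraMap (θ : tangentSections f U) (j : Spec (.of A) ⟶ X) [IsOpenImmersion j]
    (hj : j ≫ f = Spec.map (CommRingCat.ofHom (algebraMap k A))) (h : j ''ᵁ ⊤ ≤ U) (c : k) :
    immDer θ j h (algebraMap k A c) = 0 := by
  apply (immFun j).injective
  rw [immFun_immDer, immFun_algebraMap j hj, map_zero]
  simp [act, dif_algebraMap]

lemma isAffineOpen_image {A : Type u} [CommRing A] (j : Spec (.of A) ⟶ X) [IsOpenImmersion j] :
    IsAffineOpen (j ''ᵁ ⊤) :=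
  (isAffineOpen_top _).image_of_isOpenImmersion j

lemma tangent_ext_imm {A : Type u} [CommRing A] (j : Spec (.of A) ⟶ X) [IsOpenImmersion j]
    (hU : U = j ''ᵁ ⊤) {θ η : tangentSections f U} (h : ∀ a, immDer θ j hU.ge a = immDer η j hU.ge a) : θ = η := by
  subst hU
  apply tangent_ext_affine (isAffineOpen_image j)
  intro a
  obtain ⟨a, rfl⟩ := (immFun j).surjective a
  rw [← immFun_immDer θ j, ← immFun_immDer η j, h]

lemma exists_tangentSection_imm (j : Spec (.of A) ⟶ X) [IsOpenImmersion j] (hU : U = j ''ᵁ ⊤)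
    (hj : j ≫ f = Spec.map (CommRingCat.ofHom (algebraMap k A))) (D : SelfDerivation A)
    (hD : ∀ c : k, D (algebraMap k A c) = 0) :
    ∃ θ : tangentSections f U, ∀ a, immDer θ j hU.ge a = D a := by
  subst hU
  let D' : SelfDerivation Γ(X, j ''ᵁ ⊤) :=
    selfDerivation (fun a => immFun j (D ((immFun j).symm a))) (fun a b => by simp)
      (fun a b => by simp)
  have hD' : ∀ a, D' (immFun j a) = immFun j (D a) := by
    intro a
    change immFun j (D ((immFun j).symm (immFun j a))) = _
    rw [RingEquiv.symm_apply_apply]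
  obtain ⟨θ, hθ⟩ := exists_tangentSection (f := f) (isAffineOpen_image j) D' (by
    intro c
    rw [← immFun_algebraMap j hj, hD', hD, map_zero])
  refine ⟨θ, fun a => (immFun j).injective ?_⟩
  rw [immFun_immDer, hθ, hD']

lemma resFun_injective {V W : X.Opens} (h : W ≤ V) (h' : V ≤ W) :
    Function.Injective (resFun h) := by
  obtain rfl := le_antisymm h h'
  intro a b hab
  rwa [resFun_self, resFun_self] at hab

lemma tangentRes_injective {V W : X.Opens} (h : W ≤ V) (h' : V ≤ W) :
    Function.Injective (tangentRes f h) := by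
  obtain rfl := le_antisymm h h'
  exact fun a b hab => hab

/-- The empty family covers an empty open set, so functions there are all equal. -/
lemma tangent_eq_of_le_bot (h : U ≤ ⊥) (θ η : tangentSections f U) : θ = η := by
  apply tangent_ext
  intro V hV a
  exact fun_ext (ι := PEmpty) (U := PEmpty.elim) (hV.trans (h.trans bot_le)) (fun i => i.elim)

end

end Tangent

/-! ### The Euler field -/

namespace Plumbing

open Tangent

noncomputable section

section Euler

open MvPolynomial

variable {k : Type u} [Field k] {n m l : ℕ}

lemma isLocalization_endRing (n m l : ℕ) : @IsLocalization.Away (SideRing k n m l) _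
    (ChartRing.x _ _ * (ChartRing.x _ _ - 1)) (EndRing k n m l) _
      (algebraMap (SideRing k n m l) (EndRing k n m l)).toAlgebra := by
  convert (inferInstance : IsLocalization.Away
    (ChartRing.x _ _ * (ChartRing.x _ _ - 1) : SideRing k n m l) (EndRing k n m l))
  exact Algebra.algebra_ext _ _ (fun _ => rfl)

/-- Derivations over `k` of the ring of an overlap are determined by their values on the coordinate
functions. -/
lemma endRing_derivation_ext {D D' : SelfDerivation (EndRing k n m l)}
    (hD : ∀ c : k, D (algebraMap k _ c) = 0) (hD' : ∀ c : k, D' (algebraMap k _ c) = 0)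
    (hx : D (algebraMap (SideRing k n m l) _ (ChartRing.x _ _)) =
      D' (algebraMap (SideRing k n m l) _ (ChartRing.x _ _)))
    (hy : D (algebraMap (SideRing k n m l) _ (ChartRing.y _ _)) =
      D' (algebraMap (SideRing k n m l) _ (ChartRing.y _ _))) (r : EndRing k n m l) :
    D r = D' r := by
  refine Tangent.derivation_comm_of_away (algebraMap (SideRing k n m l) (EndRing k n m l))
    (ChartRing.x _ _ * (ChartRing.x _ _ - 1)) (isLocalization_endRing n m l) (RingHom.id _)
    (D := D') (D' := D)
    (fun a => ?_) r
  change D (algebraMap (SideRing k n m l) (EndRing k n m l) a) = D' _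
  obtain ⟨N, A, hA⟩ := ChartRing.exists_mul_eq_mk a
  rw [map_one, one_pow, one_mul] at hA
  subst hA
  induction A using MvPolynomial.induction_on with
  | C c =>
    rw [← MvPolynomial.algebraMap_eq, AlgHom.commutes, ← IsScalarTower.algebraMap_apply, hD']
    exact hD c
  | add p q hp hq => simp only [map_add, hp, hq]
  | mul_X p i hp =>
    have hi : D (algebraMap (SideRing k n m l) (EndRing k n m l) (ChartRing.mk _ _ (X i))) =
        D' (algebraMap (SideRing k n m l) _ (ChartRing.mk _ _ (X i))) := by
      fin_cases i
      · exact hx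
      · exact hy
    simp only [map_mul, SelfDerivation.map_mul, hp, hi]

/-- Derivations of a localization of the ring of a chart with given values on the coordinate
functions. -/
lemma exists_derivation_of_coordinates {f p : MvPolynomial (Fin 2) k} {B : Type u} [CommRing B]
    [Algebra k B] (ι : ChartRing f p →ₐ[k] B) (g : ChartRing f p)
    (hι : @IsLocalization.Away _ _ g B _ ι.toRingHom.toAlgebra) (u v : B)
    (huv : aeval ![(TrivSqZeroExt.inl (ι (ChartRing.x f p)) + TrivSqZeroExt.inr u : DualNumber B),
      TrivSqZeroExt.inl (ι (ChartRing.y f p)) + TrivSqZeroExt.inr v] f = 0) :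
    ∃ D : SelfDerivation B, (∀ c : k, D (algebraMap k _ c) = 0) ∧
      D (ι (ChartRing.x f p)) = u ∧ D (ι (ChartRing.y f p)) = v := by
  let := ι.toRingHom.toAlgebra
  have hfst : ∀ q : MvPolynomial (Fin 2) k, (aeval ![(TrivSqZeroExt.inl (ι (ChartRing.x f p)) +
      TrivSqZeroExt.inr u : DualNumber B), TrivSqZeroExt.inl (ι (ChartRing.y f p)) +
        TrivSqZeroExt.inr v] q).fst = ι (ChartRing.mk f p q) := by
    intro q
    change (TrivSqZeroExt.fstHom k B B).comp (aeval _) q = ι.comp (ChartRing.mk f p) q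
    congr 1
    ext i
    fin_cases i <;> simp [ChartRing.x, ChartRing.y]
  -- By `huv` the deformed coordinates satisfy the equation f, and p stays a unit because its first
  -- component is one. The second component of the extension of Φ to B is the derivation sought.
  let Φ : ChartRing f p →ₐ[k] DualNumber B := ChartRing.lift _ _ huv (by
    rw [TrivSqZeroExt.isUnit_iff_isUnit_fst, hfst]
    exact ChartRing.isUnit_mk_p.map ι)
  have hΦ : (TrivSqZeroExt.fstHom k B B).comp Φ = ι :=
    ChartRing.algHom_ext (by simp [Φ]) (by simp [Φ])
  have hg : IsUnit (Φ.toRingHom g) := by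
    rw [TrivSqZeroExt.isUnit_iff_isUnit_fst]
    change IsUnit ((TrivSqZeroExt.fstHom k B B).comp Φ g)
    rw [hΦ]
    exact IsLocalization.Away.algebraMap_isUnit (S := B) g
  let Ψ : B →+* DualNumber B := IsLocalization.Away.lift g hg
  have hΨ : ∀ r, Ψ (ι r) = Φ r := IsLocalization.Away.lift_eq g hg
  have h1 : ∀ r, (Ψ r).fst = r := by
    have : ((TrivSqZeroExt.fstHom B B B : DualNumber B →ₐ[B] B) : DualNumber B →+* B).comp Ψ =
        RingHom.id B := by
      apply IsLocalization.ringHom_ext (Submonoid.powers g)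
      ext r
      change (Ψ (ι r)).fst = ι r
      rw [hΨ]
      exact DFunLike.congr_fun hΦ r
    exact DFunLike.congr_fun this
  refine ⟨derivationOfDual Ψ h1, fun c => ?_, ?_, ?_⟩
  · rw [derivationOfDual_apply, ← ι.commutes, hΨ, AlgHom.commutes]
    rfl
  · rw [derivationOfDual_apply, hΨ, ChartRing.lift_x]
    simp
  · rw [derivationOfDual_apply, hΨ, ChartRing.lift_y]
    simp

/-- The derivation `x ∂/∂x` of the ring of an overlap. -/
lemma exists_euler_derivation : ∃ D : SelfDerivation (EndRing k n m l),
    (∀ c : k, D (algebraMap k _ c) = 0) ∧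
    D (algebraMap (SideRing k n m l) _ (ChartRing.x _ _)) =
      algebraMap (SideRing k n m l) _ (ChartRing.x _ _) ∧
    D (algebraMap (SideRing k n m l) _ (ChartRing.y _ _)) = 0 := by
  refine exists_derivation_of_coordinates (loc (k := k)
    (ChartRing.x _ _ * (ChartRing.x _ _ - 1) : SideRing k n m l)) _
    (isLocalization_endRing n m l) _ _ ?_
  simp only [map_mul, map_pow, aeval_X]
  -- Where x (x - 1) is invertible the chart equation reduces to y ^ l = 0, which is unaffected by
  -- deforming x alone.
  convert mul_zero _
  exact inl_add_inr_zero_pow (rel_side₂ n m l)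

end Euler

section EulerField

variable {k : Type u} [Field k] (b ν : Fin 7 → ℕ)

/-- The open set in the definition equals the affine overlap, so both conditions become equations in
`OverlapRing`. -/
lemma isEulerField_iff
    (θ : tangentSections (structureMap k b ν) (cover k b ν 1 ⊓ cover k b ν 2)) :
    IsEulerField k b ν θ ↔
      immDer θ (overlapMap k b ν .right_mid₂) (cover_one_inf_two b ν).ge
        (algebraMap (CoordRing k ν .right) _ (cx k ν .right)) =
          algebraMap (CoordRing k ν .right) _ (cx k ν .right) ∧
      immDer θ (overlapMap k b ν .right_mid₂) (cover_one_inf_two b ν).ge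
        (algebraMap (CoordRing k ν .right) _ (cy k ν .right)) = 0 := by
  have hV : cover k b ν 1 ⊓ cover k b ν 2 ⊓ chartOpen k b ν .right ≤
      overlapMap k b ν .right_mid₂ ''ᵁ ⊤ :=
    inf_le_left.trans (cover_one_inf_two b ν).le
  have hV' : overlapMap k b ν .right_mid₂ ''ᵁ ⊤ ≤
      cover k b ν 1 ⊓ cover k b ν 2 ⊓ chartOpen k b ν .right :=
    le_inf (cover_one_inf_two b ν).ge (overlapMap_le_src b ν .right_mid₂)
  have key : ∀ r s : CoordRing k ν .right,
      act θ inf_le_left (resFun (inf_le_right :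
        cover k b ν 1 ⊓ cover k b ν 2 ⊓ chartOpen k b ν .right ≤ chartOpen k b ν .right)
          (chartFun k b ν .right r)) = resFun inf_le_right (chartFun k b ν .right s) ↔
      immDer θ (overlapMap k b ν .right_mid₂) (cover_one_inf_two b ν).ge (algebraMap _ _ r) =
        algebraMap _ _ s := by
    intro r s
    rw [← (resFun_injective hV' hV).eq_iff, act_res, resFun_resFun, resFun_resFun,
      ← (immFun (overlapMap k b ν .right_mid₂)).injective.eq_iff, immFun_immDer]
    have h := resFun_immFun (j := chartMap k b ν .right) (j' := overlapMap k b ν .right_mid₂)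
      (φ := algebraMap (CoordRing k ν .right) _) rfl (overlapMap_le_src b ν .right_mid₂)
    rw [← h, ← h]
    rfl
  have h0 : resFun (inf_le_right :
      cover k b ν 1 ⊓ cover k b ν 2 ⊓ chartOpen k b ν .right ≤ chartOpen k b ν .right)
        (chartFun k b ν .right 0) = 0 := by
    rw [chartFun_eq, map_zero]
    exact map_zero (resFun _)
  have hy := key (cy k ν .right) 0
  rw [h0, map_zero] at hy
  exact and_congr (key _ _) hy

lemma eulerField_unique
    {θ η : tangentSections (structureMap k b ν) (cover k b ν 1 ⊓ cover k b ν 2)}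
    (hθ : IsEulerField k b ν θ) (hη : IsEulerField k b ν η) : θ = η := by
  rw [isEulerField_iff] at hθ hη
  apply tangent_ext_imm (overlapMap k b ν .right_mid₂) (cover_one_inf_two b ν)
  refine endRing_derivation_ext (fun c => ?_) (fun c => ?_) (hθ.1.trans hη.1.symm)
    (hθ.2.trans hη.2.symm)
  · exact immDer_algebraMap _ _ (overlapMap_structureMap b ν _) _ c
  · exact immDer_algebraMap _ _ (overlapMap_structureMap b ν _) _ c

lemma exists_eulerField :
    ∃ θ : tangentSections (structureMap k b ν) (cover k b ν 1 ⊓ cover k b ν 2),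
      IsEulerField k b ν θ := by
  obtain ⟨D, hD, hx, hy⟩ := exists_euler_derivation (k := k) (n := ν 6) (m := ν 5) (l := ν 2)
  obtain ⟨θ, hθ⟩ := exists_tangentSection_imm (overlapMap k b ν .right_mid₂)
    (cover_one_inf_two b ν) (overlapMap_structureMap b ν .right_mid₂) D hD
  refine ⟨θ, (isEulerField_iff b ν θ).2 ⟨?_, ?_⟩⟩
  · rw [hθ]
    exact hx
  · rw [hθ]
    exact hy

end EulerField

end

end Plumbing

/-! ### Differences and restrictions of vector fields -/

namespace Tangent

section

variable {k : Type u} [Field k] {X : Scheme.{u}} {f : X ⟶ Spec (.of k)} {U V : X.Opens}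
  {A : Type u} [CommRing A]

lemma immDer_sub (θ η : tangentSections f U) (j : Spec (.of A) ⟶ X) [IsOpenImmersion j]
    (h : j ''ᵁ ⊤ ≤ U) (a : A) : immDer (θ - η) j h a = immDer θ j h a - immDer η j h a := by
  apply (immFun j).injective
  rw [map_sub, immFun_immDer, immFun_immDer, immFun_immDer]
  rfl

lemma immDer_tangentRes (θ : tangentSections f U) (hV : V ≤ U) (j : Spec (.of A) ⟶ X)
    [IsOpenImmersion j] (h : j ''ᵁ ⊤ ≤ V) (a : A) :
    immDer (tangentRes f hV θ) j h a = immDer θ j (h.trans hV) a := rfl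

lemma tangentRes_neg_sub_neg {W : X.Opens} (θ : tangentSections f U) (η : tangentSections f V)
    (hU : W ≤ U) (hV : W ≤ V) :
    tangentRes f hU (-θ) - tangentRes f hV (-η) = tangentRes f hV η - tangentRes f hU θ :=
  neg_sub_neg (tangentRes f hU θ) (tangentRes f hV η)

lemma tangentRes_self (θ : tangentSections f U) : tangentRes f le_rfl θ = θ := rfl

lemma tangentRes_tangentRes {W : X.Opens} (θ : tangentSections f U) (hV : V ≤ U) (hW : W ≤ V) :
    tangentRes f hW (tangentRes f hV θ) = tangentRes f (hW.trans hV) θ := rfl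

end

end Tangent

/-! ### The contradiction between the residues, and H¹ -/

namespace Plumbing

open Tangent

noncomputable section

section Main

variable {k : Type u} [Field k]

/-- Evaluation at the origin of the chart, the point E₁ ∩ E₂; for `mid₂` it is E₂ ∩ E₃. -/
lemma exists_augmentation_mid₁ {q l : ℕ} (hq : q ≠ 0) :
    ∃ χ : MidRing k (1 - MvPolynomial.X 0) q l →ₐ[k] k,
      χ (ChartRing.x _ _) = 0 ∧ χ (ChartRing.y _ _) = 0 :=
  ⟨ChartRing.lift 0 0 (by simp [hq]) (by simp), ChartRing.lift_x _ _ _ _, ChartRing.lift_y _ _ _ _⟩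

lemma exists_augmentation_mid₂ {q l : ℕ} (hq : q ≠ 0) :
    ∃ χ : MidRing k (1 - MvPolynomial.X 1) q l →ₐ[k] k,
      χ (ChartRing.x _ _) = 0 ∧ χ (ChartRing.y _ _) = 0 :=
  ⟨ChartRing.lift 0 0 (by simp [hq]) (by simp), ChartRing.lift_x _ _ _ _, ChartRing.lift_y _ _ _ _⟩

/-- The logarithmic residue along the chain `E₁, E₂, E₃` cannot jump from `0` to `1`. -/
lemma residue_contradiction {n m l q r n' m' b₁ : ℕ} (hb : (b₁ : k) = 0) (hn : (n : k) ≠ 0)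
    (hm : (m : k) ≠ 0) (hl : l ≠ 0) (hq : (q : k) ≠ 0) (hq' : 2 ≤ q) (hr : r ≠ 0)
    (hm' : (m' : k) ≠ 0) (hn' : (n' : k) ≠ 0) (b₀ b₂ : ℕ)
    {Dl : SelfDerivation (SideRing k n m l)} {Dr : SelfDerivation (SideRing k n' m' r)}
    {D₁ : SelfDerivation (MidRing k (1 - MvPolynomial.X 0) q l)}
    {D₂ : SelfDerivation (MidRing k (1 - MvPolynomial.X 1) r q)}
    {El El' : SelfDerivation (EndRing k n m l)} {Er Er' : SelfDerivation (EndRing k n' m' r)}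
    {E : SelfDerivation
      (Localization.Away (ChartRing.y _ _ : MidRing k (1 - MvPolynomial.X 0) q l))}
    (hl₁ : ∀ a, El (algebraMap _ _ a) = algebraMap _ _ (Dl a))
    (hl₂ : ∀ a, El' (endTrans₁ k n m l q b₀ a) = endTrans₁ k n m l q b₀ (D₁ a))
    (h₁ : ∀ a, E (algebraMap _ _ a) = algebraMap _ _ (D₁ a))
    (h₂ : ∀ a, E (midTrans k q l r b₁ a) = midTrans k q l r b₁ (D₂ a))
    (hr₁ : ∀ a, Er (algebraMap _ _ a) = algebraMap _ _ (Dr a))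
    (hr₂ : ∀ a, Er' (endTrans₂ k n' m' r q b₂ a) = endTrans₂ k n' m' r q b₂ (D₂ a))
    (hEl : El (algebraMap (SideRing k n m l) _ (ChartRing.x _ _)) =
      El' (algebraMap (SideRing k n m l) _ (ChartRing.x _ _)))
    (hEr : Er (algebraMap (SideRing k n' m' r) _ (ChartRing.x _ _)) -
      Er' (algebraMap (SideRing k n' m' r) _ (ChartRing.x _ _)) =
        algebraMap (SideRing k n' m' r) _ (ChartRing.x _ _)) : False := by
  obtain ⟨w₁, hw₁⟩ := mid₁_dvd_x hq D₁
  obtain ⟨w₂, hw₂⟩ := mid₂_dvd_y hq D₂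
  obtain ⟨χ₁, hx₁, hy₁⟩ := exists_augmentation_mid₁ (k := k) (l := l) (show q ≠ 0 by omega)
  obtain ⟨χ₂, hx₂, hy₂⟩ := exists_augmentation_mid₂ (k := k) (l := q) hr
  -- At E₁ the two fields agree, so c = 0; at E₃ they differ by the Euler field, so c = 1.
  have e₁ : χ₁ w₁ = 0 := residue_mid₁ hn hm hl b₀ hl₁ hl₂ (c := 0)
    (by rw [map_zero, zero_mul, sub_eq_zero, hEl]) hw₁ χ₁ hx₁ hy₁
  have e₂ : χ₁ w₁ = χ₂ w₂ := residue_eq hq' hb h₁ h₂ hw₁ hw₂ χ₁ hx₁ hy₁ χ₂ hx₂ hy₂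
  have e₃ : χ₂ w₂ = 1 := residue_mid₂ hn' hm' hr b₂ hr₁ hr₂ (c := 1)
    (by rw [map_one, one_mul, hEr]) hw₂ χ₂ hx₂ hy₂
  exact zero_ne_one (e₁.symm.trans (e₂.trans e₃))

variable (b ν : Fin 7 → ℕ)

lemma immDer_src {U : (scheme k b ν).Opens} (θ : tangentSections (structureMap k b ν) U)
    (o : Overlap) (h : chartOpen k b ν (src o) ≤ U) (h' : overlapMap k b ν o ''ᵁ ⊤ ≤ U)
    (a : CoordRing k ν (src o)) :
    immDer θ (overlapMap k b ν o) h' (algebraMap _ (OverlapRing k ν o) a) =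
      algebraMap _ _ (immDer θ (chartMap k b ν (src o)) h a) :=
  immDer_map θ rfl h h' a

lemma immDer_tgt {U : (scheme k b ν).Opens} (θ : tangentSections (structureMap k b ν) U)
    (o : Overlap) (h : chartOpen k b ν (tgt o) ≤ U) (h' : overlapMap k b ν o ''ᵁ ⊤ ≤ U)
    (a : CoordRing k ν (tgt o)) :
    immDer θ (overlapMap k b ν o) h' (transition k b ν o a) =
      transition k b ν o (immDer θ (chartMap k b ν (tgt o)) h a) :=
  immDer_map θ (overlapMap_eq b ν o) h h' a

lemma left_mid₁_le : overlapMap k b ν .left_mid₁ ''ᵁ ⊤ ≤ cover k b ν 0 ⊓ cover k b ν 1 :=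
  le_inf ((overlapMap_le_src b ν .left_mid₁).trans (le_sup_left.trans le_sup_left))
    ((overlapMap_le_tgt b ν .left_mid₁).trans le_sup_left)

lemma mid₁_mid₂_le : overlapMap k b ν .mid₁_mid₂ ''ᵁ ⊤ ≤ cover k b ν 1 :=
  (overlapMap_le_src b ν .mid₁_mid₂).trans le_sup_left

variable {b ν}

lemma chart_residue_contradiction (hb : (b 1 : k) = 0) (hν : ∀ i, (ν i : k) ≠ 0) (hν₁ : 2 ≤ ν 1)
    {Dl : SelfDerivation (CoordRing k ν .left)} {Dr : SelfDerivation (CoordRing k ν .right)}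
    {D₁ : SelfDerivation (CoordRing k ν .mid₁)} {D₂ : SelfDerivation (CoordRing k ν .mid₂)}
    {El El' : SelfDerivation (OverlapRing k ν .left_mid₁)}
    {Er Er' : SelfDerivation (OverlapRing k ν .right_mid₂)}
    {E : SelfDerivation (OverlapRing k ν .mid₁_mid₂)}
    (hl₁ : ∀ a : CoordRing k ν .left, El (algebraMap _ _ a) = algebraMap _ _ (Dl a))
    (hl₂ : ∀ a, El' (transition k b ν .left_mid₁ a) = transition k b ν .left_mid₁ (D₁ a))
    (h₁ : ∀ a : CoordRing k ν .mid₁, E (algebraMap _ _ a) = algebraMap _ _ (D₁ a))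
    (h₂ : ∀ a, E (transition k b ν .mid₁_mid₂ a) = transition k b ν .mid₁_mid₂ (D₂ a))
    (hr₁ : ∀ a : CoordRing k ν .right, Er (algebraMap _ _ a) = algebraMap _ _ (Dr a))
    (hr₂ : ∀ a, Er' (transition k b ν .right_mid₂ a) = transition k b ν .right_mid₂ (D₂ a))
    (hEl : El (algebraMap (CoordRing k ν .left) _ (cx k ν .left)) =
      El' (algebraMap (CoordRing k ν .left) _ (cx k ν .left)))
    (hEr : Er (algebraMap (CoordRing k ν .right) _ (cx k ν .right)) -
      Er' (algebraMap (CoordRing k ν .right) _ (cx k ν .right)) =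
        algebraMap (CoordRing k ν .right) _ (cx k ν .right)) : False := by
  have hν' : ∀ i, ν i ≠ 0 := fun i h => hν i (by rw [h, Nat.cast_zero])
  exact residue_contradiction (n := ν 4) (m := ν 3) (l := ν 0) (q := ν 1) (r := ν 2)
    (m' := ν 5) (n' := ν 6) (Dl := Dl) (Dr := Dr) (D₁ := D₁) (D₂ := D₂) (El := El) (El' := El')
    (Er := Er) (Er' := Er') (E := E) hb (hν 4) (hν 3) (hν' 0) (hν 1) hν₁ (hν' 2) (hν 5) (hν 6)
    (b 0) (b 2) hl₁ hl₂ h₁ h₂ hr₁ hr₂ hEl hEr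

/-- If the characteristic divides the self-intersection number of `E₂` and no multiplicity, then
the Euler field is not the difference of vector fields on `U₂` and `U₁` of which the second extends
to `U₀`. -/
theorem not_isEulerField_sub (hb : (b 1 : k) = 0) (hν : ∀ i, (ν i : k) ≠ 0) (hν₁ : 2 ≤ ν 1)
    (θ₀ : tangentSections (structureMap k b ν) (cover k b ν 0))
    (θ₁ : tangentSections (structureMap k b ν) (cover k b ν 1))
    (θ₂ : tangentSections (structureMap k b ν) (cover k b ν 2))
    (h₀₁ : tangentRes _ (inf_le_left : cover k b ν 0 ⊓ cover k b ν 1 ≤ cover k b ν 0) θ₀ =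
      tangentRes _ inf_le_right θ₁) :
    ¬ IsEulerField k b ν (tangentRes _ inf_le_right θ₂ - tangentRes _ inf_le_left θ₁) := by
  intro hE
  replace hE := ((isEulerField_iff b ν _).1 hE).1
  rw [immDer_sub, immDer_tangentRes, immDer_tangentRes] at hE
  have hl : chartOpen k b ν .left ≤ cover k b ν 0 := le_sup_left.trans le_sup_left
  have hm₁ : chartOpen k b ν .mid₁ ≤ cover k b ν 1 := le_sup_left
  have hm₂ : chartOpen k b ν .mid₂ ≤ cover k b ν 1 := le_sup_right
  have hr : chartOpen k b ν .right ≤ cover k b ν 2 := le_sup_left.trans le_sup_left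
  have h01 := left_mid₁_le (k := k) b ν
  have h12 := (cover_one_inf_two (k := k) b ν).ge
  have hEl : immDer θ₀ (overlapMap k b ν .left_mid₁) (h01.trans inf_le_left)
      (algebraMap (CoordRing k ν .left) _ (cx k ν .left)) =
        immDer θ₁ (overlapMap k b ν .left_mid₁) (h01.trans inf_le_right)
          (algebraMap (CoordRing k ν .left) _ (cx k ν .left)) := by
    rw [← immDer_tangentRes θ₀ inf_le_left _ h01, h₀₁, immDer_tangentRes]
  have hl₁ : ∀ a : CoordRing k ν .left, immDer θ₀ (overlapMap k b ν .left_mid₁) _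
      (algebraMap _ _ a) = algebraMap _ _ (immDer (A := CoordRing k ν .left) θ₀
        (chartMap k b ν .left) hl a) := immDer_src b ν θ₀ .left_mid₁ hl (h01.trans inf_le_left)
  have hl₂ : ∀ a, immDer θ₁ (overlapMap k b ν .left_mid₁) _ (transition k b ν .left_mid₁ a) =
      transition k b ν .left_mid₁ (immDer (A := CoordRing k ν .mid₁) θ₁
        (chartMap k b ν .mid₁) hm₁ a) :=
    immDer_tgt b ν θ₁ .left_mid₁ hm₁ (h01.trans inf_le_right)
  have h₁ : ∀ a : CoordRing k ν .mid₁, immDer θ₁ (overlapMap k b ν .mid₁_mid₂) _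
      (algebraMap _ _ a) = algebraMap _ _ (immDer (A := CoordRing k ν .mid₁) θ₁
        (chartMap k b ν .mid₁) hm₁ a) :=
    immDer_src b ν θ₁ .mid₁_mid₂ hm₁ (mid₁_mid₂_le b ν)
  have h₂ : ∀ a, immDer θ₁ (overlapMap k b ν .mid₁_mid₂) _ (transition k b ν .mid₁_mid₂ a) =
      transition k b ν .mid₁_mid₂ (immDer (A := CoordRing k ν .mid₂) θ₁
        (chartMap k b ν .mid₂) hm₂ a) :=
    immDer_tgt b ν θ₁ .mid₁_mid₂ hm₂ (mid₁_mid₂_le b ν)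
  have hr₁ : ∀ a : CoordRing k ν .right, immDer θ₂ (overlapMap k b ν .right_mid₂) _
      (algebraMap _ _ a) = algebraMap _ _ (immDer (A := CoordRing k ν .right) θ₂
        (chartMap k b ν .right) hr a) :=
    immDer_src b ν θ₂ .right_mid₂ hr (h12.trans inf_le_right)
  have hr₂ : ∀ a, immDer θ₁ (overlapMap k b ν .right_mid₂) _ (transition k b ν .right_mid₂ a) =
      transition k b ν .right_mid₂ (immDer (A := CoordRing k ν .mid₂) θ₁
        (chartMap k b ν .mid₂) hm₂ a) :=
    immDer_tgt b ν θ₁ .right_mid₂ hm₂ (h12.trans inf_le_left)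
  -- Only derivations of rings and their compatibilities are used from here on.
  generalize immDer θ₀ (overlapMap k b ν .left_mid₁) _ = El at hl₁ hEl
  generalize immDer θ₁ (overlapMap k b ν .left_mid₁) _ = El' at hl₂ hEl
  generalize immDer θ₁ (overlapMap k b ν .mid₁_mid₂) _ = E at h₁ h₂
  generalize immDer θ₂ (overlapMap k b ν .right_mid₂) _ = Er at hr₁ hE
  generalize immDer θ₁ (overlapMap k b ν .right_mid₂) _ = Er' at hr₂ hE
  generalize immDer (A := CoordRing k ν .left) θ₀ (chartMap k b ν .left) hl = Dl at hl₁
  generalize immDer (A := CoordRing k ν .mid₁) θ₁ (chartMap k b ν .mid₁) hm₁ = D₁ at hl₂ h₁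
  generalize immDer (A := CoordRing k ν .mid₂) θ₁ (chartMap k b ν .mid₂) hm₂ = D₂ at h₂ hr₂
  generalize immDer (A := CoordRing k ν .right) θ₂ (chartMap k b ν .right) hr = Dr at hr₁
  exact chart_residue_contradiction hb hν hν₁ hl₁ hl₂ h₁ h₂ hr₁ hr₂ hEl hE

/-- If the characteristic divides the self-intersection number of `E₂` and no multiplicity, then
`H¹(P, Θ_P) ≠ 0`. -/
theorem nontrivial_H1_structureMap (hb : (b 1 : k) = 0) (hν : ∀ i, (ν i : k) ≠ 0)
    (hν₁ : 2 ≤ ν 1) : Nontrivial (H1 (structureMap k b ν)) := by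
  obtain ⟨θ, hθ⟩ := exists_eulerField (k := k) b ν
  -- Since U₀ ∩ U₂ is empty, the Euler field is a section on (U₀ ∪ U₁) ∩ U₂.
  have hle : (cover k b ν 0 ⊔ cover k b ν 1) ⊓ cover k b ν 2 ≤ cover k b ν 1 ⊓ cover k b ν 2 := by
    rw [inf_sup_right, cover_zero_inf_two, bot_sup_eq]
  have hge : cover k b ν 1 ⊓ cover k b ν 2 ≤ (cover k b ν 0 ⊔ cover k b ν 1) ⊓ cover k b ν 2 :=
    inf_le_inf_right _ le_sup_right
  refine MayerVietoris.nontrivial_H1 (F := tangentSheaf (structureMap k b ν))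
    (U := cover k b ν 0 ⊔ cover k b ν 1) (V := cover k b ν 2) ?_ (tangentRes _ hle θ) ?_
  · rw [eq_top_iff, ← iSup_cover b ν]
    refine iSup_le fun i => ?_
    fin_cases i
    exacts [le_sup_left.trans le_sup_left, le_sup_right.trans le_sup_left, le_sup_right]
  · intro α β h
    change tangentSections (structureMap k b ν) _ at α β
    have hα : cover k b ν 0 ≤ cover k b ν 0 ⊔ cover k b ν 1 := le_sup_left
    have hα' : cover k b ν 1 ≤ cover k b ν 0 ⊔ cover k b ν 1 := le_sup_right
    -- Mayer–Vietoris gives θ = α - β, whereas the Čech difference is θ₂ - θ₁; hence the signs.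
    refine not_isEulerField_sub hb hν hν₁ (-tangentRes _ hα α) (-tangentRes _ hα' α) (-β) rfl ?_
    rw [tangentRes_neg_sub_neg, tangentRes_tangentRes]
    convert hθ
    exact congrArg (tangentRes (structureMap k b ν) hge) h

/-! ### Čech cocycles -/

/-- The cocycle condition for (i, i, i) reads c + c = c. -/
lemma cechCocycle_self {X : Scheme.{u}} {f : X ⟶ Spec (.of k)} {ι : Type} {U : ι → X.Opens}
    {c : CechCochain f U} (hc : IsCechCocycle c) (i : ι) : c i i = 0 := by
  refine tangentRes_injective (f := f) (inf_le_left : U i ⊓ U i ⊓ U i ≤ U i ⊓ U i)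
    (le_inf le_rfl inf_le_left) ?_
  rw [map_zero]
  exact add_eq_left.1 (hc i i i)

lemma cechCocycle_eq_zero_of_symm {X : Scheme.{u}} {f : X ⟶ Spec (.of k)} {ι : Type}
    {U : ι → X.Opens} {c : CechCochain f U} (hc : IsCechCocycle c) {i j : ι} (h : c i j = 0) :
    c j i = 0 := by
  have h' := hc j i j
  rw [h, cechCocycle_self hc, map_zero, map_zero, add_zero] at h'
  refine tangentRes_injective (f := f) (inf_le_left : U j ⊓ U i ⊓ U j ≤ U j ⊓ U i)
    (le_inf le_rfl inf_le_left) ?_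
  rw [map_zero]
  exact h'

lemma cechCocycle_sub {X : Scheme.{u}} {f : X ⟶ Spec (.of k)} {ι : Type} {U : ι → X.Opens}
    {c d : CechCochain f U} (hc : IsCechCocycle c) (hd : IsCechCocycle d) :
    IsCechCocycle (c - d) := by
  intro i j l
  have h := congrArg₂ (· - ·) (hc i j l) (hd i j l)
  simp only [Pi.sub_apply, map_sub] at h ⊢
  rw [← h]
  abel

lemma exists_hom_int {G : Type u} [AddCommGroup G] (x : G) : ∃ g : ℤ →+ G, g 1 = x :=
  ⟨zmultiplesHom G x, by simp⟩

/-- The cocycle `(e j - e i) θ` for a section `θ` on an open set that contains `U i ∩ U j` whenever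
`e i ≠ e j`. -/
lemma exists_cechCocycle {X : Scheme.{u}} {f : X ⟶ Spec (.of k)} {ι : Type} {U : ι → X.Opens}
    {V : X.Opens} (θ : tangentSections f V) (e : ι → ℤ)
    (he : ∀ i j, e i = e j ∨ U i ⊓ U j ≤ V) :
    ∃ c : CechCochain f U, IsCechCocycle c ∧ (∀ i j, e i = e j → c i j = 0) ∧
      ∀ i j, e j = e i + 1 → ∃ h : U i ⊓ U j ≤ V, c i j = tangentRes f h θ := by
  obtain ⟨g, hg⟩ := exists_hom_int θ
  -- When e i = e j the component is zero and U i ∩ U j need not lie in V; the first clause compares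
  -- with (e j - e i) θ only where both are defined.
  have key : ∀ i j, ∃ c : tangentSections f (U i ⊓ U j),
      (∀ (W : X.Opens) (h : W ≤ U i ⊓ U j) (h' : W ≤ V),
        tangentRes f h c = tangentRes f h' (g (e j - e i))) ∧ (e i = e j → c = 0) := by
    intro i j
    by_cases h : e i = e j
    · exact ⟨0, fun W _ _ => by rw [h, sub_self, map_zero, map_zero, map_zero], fun _ => rfl⟩
    · have h' := (he i j).resolve_left h
      exact ⟨tangentRes f h' (g (e j - e i)), fun W _ _ => tangentRes_tangentRes _ _ _,
        fun h'' => absurd h'' h⟩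
  choose c hc hc' using key
  have he' : ∀ i j, e j = e i + 1 → U i ⊓ U j ≤ V := fun i j h =>
    (he i j).resolve_left (by omega)
  refine ⟨c, fun i j l => ?_, hc', fun i j h => ⟨he' i j h, ?_⟩⟩
  -- Inside V the cocycle condition is (e j - e i) + (e l - e j) = e l - e i. If the triple
  -- intersection is not contained in V, then all three values of e coincide and every term is zero.
  · by_cases h : U i ⊓ U j ⊓ U l ≤ V
    · refine (congrArg₂ (· + ·) (hc i j _ _ h) (hc j l _ _ h)).trans
        (Eq.trans ?_ (hc i l _ _ h).symm)
      exact ((tangentRes f h).map_add _ _).symm.trans (congrArg (tangentRes f h)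
        ((g.map_add _ _).symm.trans (congrArg g (by ring))))
    · have h1 : e i = e j := (he i j).resolve_right fun h' => h (inf_le_left.trans h')
      have h2 : e j = e l := (he j l).resolve_right fun h' =>
        h ((inf_le_inf_right _ inf_le_right).trans h')
      have h0 : ∀ {a b} (h : e a = e b) (h' : U i ⊓ U j ⊓ U l ≤ U a ⊓ U b),
          tangentRes f h' (c a b) = 0 := fun h h' =>
        (congrArg (tangentRes f h') (hc' _ _ h)).trans (tangentRes f h').map_zero
      refine Eq.trans ?_ (h0 (h1.trans h2) (inf_le_inf_right _ inf_le_left)).symm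
      rw [h0 h1 inf_le_left, zero_add]
      exact h0 h2 (inf_le_inf_right _ inf_le_right)
  · have h' : g (e j - e i) = θ := (congrArg g (by omega)).trans hg
    rw [← h', ← hc i j _ le_rfl (he' i j h), tangentRes_self]

/-- Existence takes the weights 0, 0, 1 on U₀, U₁, U₂. For uniqueness, the difference of two such
cocycles vanishes at (0, 1) and (1, 2), hence on the diagonal and under exchange of indices; over U₀
∩ U₂ = ∅ nothing is left to check. -/
theorem existsUnique_cechCocycle : ∃! c : CechCochain (structureMap k b ν) (cover k b ν),
    IsCechCocycle c ∧ c 0 1 = 0 ∧ IsEulerField k b ν (c 1 2) := by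
  have h02 := (cover_zero_inf_two (k := k) b ν).le
  have h20 : cover k b ν 2 ⊓ cover k b ν 0 ≤ ⊥ := (inf_comm _ _).le.trans h02
  obtain ⟨θ, hθ⟩ := exists_eulerField (k := k) b ν
  let e : Fin 3 → ℤ := ![0, 0, 1]
  have he : ∀ i j, e i = e j ∨ cover k b ν i ⊓ cover k b ν j ≤ cover k b ν 1 ⊓ cover k b ν 2
    | 0, 0 => .inl rfl
    | 0, 1 => .inl rfl
    | 0, 2 => .inr (h02.trans bot_le)
    | 1, 0 => .inl rfl
    | 1, 1 => .inl rfl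
    | 1, 2 => .inr le_rfl
    | 2, 0 => .inr (h20.trans bot_le)
    | 2, 1 => .inr (inf_comm _ _).le
    | 2, 2 => .inl rfl
  obtain ⟨c, hc, hc0, hc1⟩ := exists_cechCocycle θ e he
  have hc12 : c 1 2 = θ := (hc1 1 2 rfl).choose_spec
  refine ⟨c, ⟨hc, hc0 0 1 rfl, hc12 ▸ hθ⟩, ?_⟩
  rintro d ⟨hd, hd01, hd12⟩
  have hdc := cechCocycle_sub hd hc
  have h01 : (d - c) 0 1 = 0 := sub_eq_zero.2 (hd01.trans (hc0 0 1 rfl).symm)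
  have h12 : (d - c) 1 2 = 0 := sub_eq_zero.2 ((eulerField_unique b ν hd12 hθ).trans hc12.symm)
  refine sub_eq_zero.1 (funext fun i => funext fun j => ?_)
  match i, j with
  | 0, 0 => exact cechCocycle_self hdc 0
  | 0, 1 => exact h01
  | 0, 2 => exact tangent_eq_of_le_bot h02 _ _
  | 1, 0 => exact cechCocycle_eq_zero_of_symm hdc h01
  | 1, 1 => exact cechCocycle_self hdc 1
  | 1, 2 => exact h12
  | 2, 0 => exact tangent_eq_of_le_bot h20 _ _
  | 2, 1 => exact cechCocycle_eq_zero_of_symm hdc h12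
  | 2, 2 => exact cechCocycle_self hdc 2

end Main

end

end Plumbing

/-! ### The example in characteristic 3 -/

theorem mainTheorem4 (k : Type u) [Field k] [IsAlgClosed k] [CharP k 3] :
    Plumbing.IsStarDTilde 3 Plumbing.exGraph ∧
    Plumbing.IsPlumbingMultiplicity 3 Plumbing.exGraph Plumbing.exMult ∧
    Nontrivial (Tangent.H1 (Plumbing.structureMap k Plumbing.exB Plumbing.exMult)) ∧
    iSup (Plumbing.cover k Plumbing.exB Plumbing.exMult) = ⊤ ∧
    Plumbing.cover k Plumbing.exB Plumbing.exMult 0 ⊓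
      Plumbing.cover k Plumbing.exB Plumbing.exMult 2 = ⊥ ∧
    (∃! c : Tangent.CechCochain (Plumbing.structureMap k Plumbing.exB Plumbing.exMult)
        (Plumbing.cover k Plumbing.exB Plumbing.exMult),
      Tangent.IsCechCocycle c ∧ c 0 1 = 0 ∧
        Plumbing.IsEulerField k Plumbing.exB Plumbing.exMult (c 1 2)) ∧
    ∀ c : Tangent.CechCochain (Plumbing.structureMap k Plumbing.exB Plumbing.exMult)
        (Plumbing.cover k Plumbing.exB Plumbing.exMult),
      Tangent.IsCechCocycle c → c 0 1 = 0 →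
        Plumbing.IsEulerField k Plumbing.exB Plumbing.exMult (c 1 2) →
        ¬ Tangent.IsCechCoboundary c := by
  -- The arithmetic input: 3 divides E₂² = -3 but none of the multiplicities.
  have hb : (Plumbing.exB 1 : k) = 0 := (CharP.cast_eq_zero_iff k 3 _).2 (by decide)
  have hν : ∀ i, (Plumbing.exMult i : k) ≠ 0 := by
    have h : ∀ i, ¬ 3 ∣ Plumbing.exMult i := by decide
    exact fun i hi => h i ((CharP.cast_eq_zero_iff k 3 _).1 hi)
  have hν₁ : 2 ≤ Plumbing.exMult 1 := by decide
  refine ⟨Plumbing.isStarDTilde_exGraph, Plumbing.isPlumbingMultiplicity_exMult,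
    Plumbing.nontrivial_H1_structureMap hb hν hν₁, Plumbing.iSup_cover _ _,
    Plumbing.cover_zero_inf_two _ _, Plumbing.existsUnique_cechCocycle, ?_⟩
  rintro c - h01 h12 ⟨θ, hθ⟩
  rw [hθ 1 2] at h12
  rw [hθ 0 1, sub_eq_zero] at h01
  exact Plumbing.not_isEulerField_sub hb hν hν₁ (θ 0) (θ 1) (θ 2) h01.symm h12
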